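/- Let $n,n_d\ge 0$ be integers, $h\ge 0$ a real number, and let $A_0,A_1\in\mathbb R^{n\times n}$, $C_d\in\mathbb R^{n\times n_d}$, $A_d\in\mathbb R^{n_d\times n_d}$, $B_d\in\mathbb R^{n_d\times n}$. Put $A_D(\theta)=C_d e^{A_d\theta}B_d$ and consider the time-delay system $$\dot x(t)=A_0x(t)+A_1x(t-h)+\int_{-h}^0A_D(\theta)x(t+\theta)\,d\theta .$$ Its spectrum is $$\Lambda=\Bigl\{\lambda\in\mathbb C:\ \det\Bigl(\lambda I-A_0-e^{-\lambda h}A_1-\int_{-h}^0e^{\lambda\theta}A_D(\theta)\,d\theta\Bigr)=0\Bigr\},$$ and the spectrum condition states that $-\lambda\notin\Lambda$ for every $\lambda\in\Lambda$. For $Q\in\mathbb R^{n\times n}$, a solution of the ODEc is a tuple of differentiable functions $\Omega_1,\Omega_2:\mathbb R\to\mathbb R^{n\times n}$, $\Omega_3,\Omega_4:\mathbb R\to\mathbb R^{n\times n_d}$, $\Omega_5,\Omega_6:\mathbb R\to\mathbb R^{n_d\times n}$ that satisfies, for all $\tau\in\mathbb R$, $$\begin{aligned} \dot\Omega_1(\tau)&=\Omega_1(\tau)A_0+\Omega_2(\tau)A_1+\Omega_3(\tau)B_d+\Omega_4(\tau)B_d,\\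 \dot\Omega_2(\tau)&=-A_1^{\top}\Omega_1(\tau)-A_0^{\top}\Omega_2(\tau)-B_d^{\top}\Omega_5(\tau)-B_d^{\top}\Omega_6(\tau),\\ \dot\Omega_3(\tau)&=-\Omega_3(\tau)A_d+\Omega_1(\tau)C_d,\\ \dot\Omega_4(\tau)&=-\Omega_4(\tau)A_d-\Omega_2(\tau)C_de^{-A_dh},\\ \dot\Omega_5(\tau)&=A_d^{\top}\Omega_5(\tau)+(C_de^{-A_dh})^{\top}\Omega_1(\tau),\\ \dot\Omega_6(\tau)&=A_d^{\top}\Omega_6(\tau)-C_d^{\top}\Omega_2(\tau), \end{aligned}$$ together with the split-boundary conditions $$-Q=\Omega_1(0)A_0+\Omega_2(0)A_1+\Omega_4(0)B_d+A_1^{\top}\Omega_1(h)+A_0^{\top}\Omega_2(h)+B_d^{\top}\Omega_5(h),$$ $$\Omega_1(0)=\Omega_2(h),\qquad \Omega_3(0)=0,\quad \Omega_4(h)=0,\quad \Omega_5(0)=0,\quad \Omega_6(h)=0 .$$ Then the ODEc has a unique solution for every symmetric $Q\in\mathbb R^{n\times n}$ if and only if the spectrum condition holds. -/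

import Mathlib

open scoped Matrix

noncomputable section

/-- Data of the time-delay system
`x'(t) = A₀ x(t) + A₁ x(t - h) + ∫_{-h}^0 A_D(θ) x(t + θ) dθ`, with `n` states and a distributed
delay kernel `A_D(θ) = C_d e^{A_d θ} B_d` of inner dimension `d`. -/
structure DelaySystem (n d : ℕ) where
  h : ℝ
  A₀ : Matrix (Fin n) (Fin n) ℝ
  A₁ : Matrix (Fin n) (Fin n) ℝ
  C_d : Matrix (Fin n) (Fin d) ℝ
  A_d : Matrix (Fin d) (Fin d) ℝ
  B_d : Matrix (Fin d) (Fin n) ℝ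

/-- Six matrix-valued functions of a real variable: the unknowns of the ODEc. -/
structure ODEcUnknowns (n d : ℕ) where
  Ω₁ : ℝ → Matrix (Fin n) (Fin n) ℝ
  Ω₂ : ℝ → Matrix (Fin n) (Fin n) ℝ
  Ω₃ : ℝ → Matrix (Fin n) (Fin d) ℝ
  Ω₄ : ℝ → Matrix (Fin n) (Fin d) ℝ
  Ω₅ : ℝ → Matrix (Fin d) (Fin n) ℝ
  Ω₆ : ℝ → Matrix (Fin d) (Fin n) ℝ

/-- `HasMatrixDeriv Ω Ω' τ`: the matrix-valued function `Ω` is differentiable at `τ` (entry by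
entry) with derivative the matrix `Ω'`. -/
def HasMatrixDeriv {p q : ℕ} (Ω : ℝ → Matrix (Fin p) (Fin q) ℝ)
    (Ω' : Matrix (Fin p) (Fin q) ℝ) (τ : ℝ) : Prop :=
  ∀ i j, HasDerivAt (fun t => Ω t i j) (Ω' i j) τ

namespace DelaySystem

variable {n d : ℕ} (S : DelaySystem n d)

/-- The distributed delay kernel `A_D(θ) = C_d e^{A_d θ} B_d`. -/
def A_D (θ : ℝ) : Matrix (Fin n) (Fin n) ℝ :=
  S.C_d * NormedSpace.exp (θ • S.A_d) * S.B_d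

/-- The constant matrix `C_d e^{-A_d h}`. -/
def C_dh : Matrix (Fin n) (Fin d) ℝ :=
  S.C_d * NormedSpace.exp ((-S.h) • S.A_d)

/-- `Ω` solves the ODEc with right-hand side `Q`: the linear differential equation holds at every
real `τ`, and the split-boundary conditions couple the values at `0` and `h`. -/
structure IsODEcSolution (Q : Matrix (Fin n) (Fin n) ℝ) (Ω : ODEcUnknowns n d) : Prop where
  deriv₁ : ∀ τ, HasMatrixDeriv Ω.Ω₁
    (Ω.Ω₁ τ * S.A₀ + Ω.Ω₂ τ * S.A₁ + Ω.Ω₃ τ * S.B_d + Ω.Ω₄ τ * S.B_d) τ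
  deriv₂ : ∀ τ, HasMatrixDeriv Ω.Ω₂
    (-(S.A₁ᵀ * Ω.Ω₁ τ) - S.A₀ᵀ * Ω.Ω₂ τ - S.B_dᵀ * Ω.Ω₅ τ - S.B_dᵀ * Ω.Ω₆ τ) τ
  deriv₃ : ∀ τ, HasMatrixDeriv Ω.Ω₃ (-(Ω.Ω₃ τ * S.A_d) + Ω.Ω₁ τ * S.C_d) τ
  deriv₄ : ∀ τ, HasMatrixDeriv Ω.Ω₄ (-(Ω.Ω₄ τ * S.A_d) - Ω.Ω₂ τ * S.C_dh) τ
  deriv₅ : ∀ τ, HasMatrixDeriv Ω.Ω₅ (S.A_dᵀ * Ω.Ω₅ τ + S.C_dhᵀ * Ω.Ω₁ τ) τ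
  deriv₆ : ∀ τ, HasMatrixDeriv Ω.Ω₆ (S.A_dᵀ * Ω.Ω₆ τ - S.C_dᵀ * Ω.Ω₂ τ) τ
  algebraic : -Q = Ω.Ω₁ 0 * S.A₀ + Ω.Ω₂ 0 * S.A₁ + Ω.Ω₄ 0 * S.B_d
    + S.A₁ᵀ * Ω.Ω₁ S.h + S.A₀ᵀ * Ω.Ω₂ S.h + S.B_dᵀ * Ω.Ω₅ S.h
  boundary₁₂ : 0 = Ω.Ω₁ 0 - Ω.Ω₂ S.h
  boundary₃ : 0 = Ω.Ω₃ 0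
  boundary₄ : 0 = Ω.Ω₄ S.h
  boundary₅ : 0 = Ω.Ω₅ 0
  boundary₆ : 0 = Ω.Ω₆ S.h

/-- The characteristic matrix `λ I - A₀ - e^{-λ h} A₁ - ∫_{-h}^0 e^{λ θ} A_D(θ) dθ`, the integral
being taken entry by entry. -/
def charMatrix (lam : ℂ) : Matrix (Fin n) (Fin n) ℂ :=
  lam • (1 : Matrix (Fin n) (Fin n) ℂ) - S.A₀.map Complex.ofReal
    - Complex.exp (-lam * S.h) • S.A₁.map Complex.ofReal
    - Matrix.of fun i j => ∫ θ in (-S.h)..0, Complex.exp (lam * θ) * (S.A_D θ i j : ℂ)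

/-- The spectrum `Λ` of the time-delay system: the complex roots of its characteristic
function. -/
def delaySpectrum : Set ℂ :=
  {lam | (S.charMatrix lam).det = 0}

/-- The spectrum condition: no `λ ∈ Λ` has `-λ ∈ Λ`. -/
def SpectrumCondition : Prop :=
  ∀ lam ∈ S.delaySpectrum, -lam ∉ S.delaySpectrum

end DelaySystem

end

/-!
The ODEc is a square linear boundary value problem: propagating the state from `0` to `h` by the
linear flow turns it into a linear equation for the state at `0` with as many equations as
unknowns. Hence it is uniquely solvable for every `Q` exactly when its homogeneous version has only
the zero solution (`DelaySystem.forall_existsUnique_iff`), and it remains to show that a nonzero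
homogeneous solution exists exactly when some `λ` has both `λ` and `-λ` in the spectrum. Taking real
and imaginary parts allows the homogeneous problem to be treated over `ℂ`. Write `Δ` for the
characteristic matrix.

If `uᵀ Δ(λ) = 0` and `wᵀ Δ(-λ) = 0`, then `P = w uᵀ` satisfies `P Δ(λ) = 0` and `Pᵀ Δ(-λ) = 0`, and
`Ω₁ = e^{λt} P`, `Ω₂ = e^{λ(t-h)} P` extend to a homogeneous solution
(`ComplexCoeffs.exists_homogeneousSolution`).

Conversely, the space of homogeneous solutions is finite-dimensional, and the heart of the proof is
that it is invariant under an infinitesimal time shift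
(`ComplexCoeffs.IsHomogeneousSolution.shift`). The shift acts on `Ω₁`, `Ω₂`, `Ω₃ + Ω₄` and
`Ω₅ + Ω₆` as differentiation; on the individual summands it is differentiation with an exponential
correction. That it preserves the algebraic boundary condition is not a formal consequence of the
boundary values: it rests on an exchange of the order of integration in a double integral
(`exists_forward_convolution`), on a conserved quantity (`boundary_identity`), and on the
symmetry `Ω ↦ Ω.reflect h`, which reverses time and transposes. An eigenvector of the shift with
eigenvalue `λ` is exponential, `Ω₁ = e^{λt} P` and `Ω₂ = e^{λ(t-h)} P` with `P ≠ 0`, so that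
`P Δ(λ) = 0`; its reflection gives `Pᵀ Δ(-λ) = 0`
(`ComplexCoeffs.exists_mul_charMatrix_eq_zero`).
-/

noncomputable section

/-! ### Entrywise derivatives of matrix-valued functions -/

/-- `HasMatDeriv F F' τ`: the complex matrix-valued function `F` of a real variable has, entry by
entry, the derivative `F'` at `τ`. -/
def HasMatDeriv {p q : ℕ} (F : ℝ → Matrix (Fin p) (Fin q) ℂ)
    (F' : Matrix (Fin p) (Fin q) ℂ) (τ : ℝ) : Prop :=
  ∀ i j, HasDerivAt (fun t => F t i j) (F' i j) τ

namespace HasMatDeriv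

variable {p q r : ℕ} {F G : ℝ → Matrix (Fin p) (Fin q) ℂ} {F' G' : Matrix (Fin p) (Fin q) ℂ}
  {τ : ℝ}

theorem congr_deriv (hF : HasMatDeriv F F' τ) (e : F' = G') : HasMatDeriv F G' τ := e ▸ hF

theorem const (M : Matrix (Fin p) (Fin q) ℂ) : HasMatDeriv (fun _ => M) 0 τ :=
  fun _ _ => hasDerivAt_const _ _

theorem add (hF : HasMatDeriv F F' τ) (hG : HasMatDeriv G G' τ) :
    HasMatDeriv (fun t => F t + G t) (F' + G') τ :=
  fun i j => (hF i j).fun_add (hG i j)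

theorem sub (hF : HasMatDeriv F F' τ) (hG : HasMatDeriv G G' τ) :
    HasMatDeriv (fun t => F t - G t) (F' - G') τ :=
  fun i j => (hF i j).fun_sub (hG i j)

theorem neg (hF : HasMatDeriv F F' τ) : HasMatDeriv (fun t => -F t) (-F') τ :=
  fun i j => (hF i j).fun_neg

theorem transpose (hF : HasMatDeriv F F' τ) : HasMatDeriv (fun t => (F t)ᵀ) F'ᵀ τ :=
  fun i j => hF j i

theorem smul {c : ℝ → ℂ} {c' : ℂ} (hc : HasDerivAt c c' τ) (hF : HasMatDeriv F F' τ) :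
    HasMatDeriv (fun t => c t • F t) (c' • F τ + c τ • F') τ :=
  fun i j => hc.mul (hF i j)

theorem const_smul (c : ℂ) (hF : HasMatDeriv F F' τ) : HasMatDeriv (fun t => c • F t) (c • F') τ :=
  fun i j => (hF i j).const_mul c

theorem mul {K : ℝ → Matrix (Fin q) (Fin r) ℂ} {K' : Matrix (Fin q) (Fin r) ℂ}
    (hF : HasMatDeriv F F' τ) (hK : HasMatDeriv K K' τ) :
    HasMatDeriv (fun t => F t * K t) (F' * K τ + F τ * K') τ := by
  intro i j
  simp only [Matrix.mul_apply, Matrix.add_apply, ← Finset.sum_add_distrib]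
  exact HasDerivAt.fun_sum fun k _ => (hF i k).fun_mul (hK k j)

theorem mul_const (hF : HasMatDeriv F F' τ) (M : Matrix (Fin q) (Fin r) ℂ) :
    HasMatDeriv (fun t => F t * M) (F' * M) τ :=
  (hF.mul (const M)).congr_deriv (by simp)

theorem const_mul (M : Matrix (Fin r) (Fin p) ℂ) (hF : HasMatDeriv F F' τ) :
    HasMatDeriv (fun t => M * F t) (M * F') τ :=
  ((const M).mul hF).congr_deriv (by simp)

theorem comp_const_sub {c : ℝ} (hF : HasMatDeriv F F' (c - τ)) :
    HasMatDeriv (fun t => F (c - t)) (-F') τ :=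
  fun i j => (hF i j).comp_const_sub c τ

theorem comp_add_const {c : ℝ} (hF : HasMatDeriv F F' (τ + c)) :
    HasMatDeriv (fun t => F (t + c)) F' τ :=
  fun i j => (hF i j).comp_add_const τ c

theorem comp_const_add {c : ℝ} (hF : HasMatDeriv F F' (c + τ)) :
    HasMatDeriv (fun t => F (c + t)) F' τ :=
  fun i j => (hF i j).comp_const_add c τ

theorem unique (hF : HasMatDeriv F F' τ) (hF₂ : HasMatDeriv F G' τ) : F' = G' := by
  ext i j
  exact (hF i j).unique (hF₂ i j)

theorem eq_of_forall_zero (hF : ∀ t, HasMatDeriv F 0 t) (a b : ℝ) : F a = F b := by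
  ext i j
  exact is_const_of_deriv_eq_zero (fun t => (hF t i j).differentiableAt)
    (fun t => (hF t i j).deriv) a b

theorem exists_primitive (hF : ∀ i j, Continuous fun t => F t i j) :
    ∃ H : ℝ → Matrix (Fin p) (Fin q) ℂ, H 0 = 0 ∧ ∀ t, HasMatDeriv H (F t) t := by
  refine ⟨fun t => Matrix.of fun i j => ∫ s in (0 : ℝ)..t, F s i j, ?_, fun t i j => ?_⟩
  · ext i j
    simp
  · exact intervalIntegral.integral_hasDerivAt_right ((hF i j).intervalIntegrable _ _)
      ((hF i j).stronglyMeasurableAtFilter _ _) (hF i j).continuousAt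

theorem continuous_entry {F' : ℝ → Matrix (Fin p) (Fin q) ℂ} (hF : ∀ t, HasMatDeriv F (F' t) t)
    (i : Fin p) (j : Fin q) : Continuous fun t => F t i j :=
  continuous_iff_continuousAt.2 fun t => (hF t i j).continuousAt

end HasMatDeriv

/-! ### The matrix exponential -/

section MatrixExp

variable {q : ℕ} (A : Matrix (Fin q) (Fin q) ℂ)

/-- The one-parameter group `t ↦ e^{tA}`. -/
def matExp (t : ℝ) : Matrix (Fin q) (Fin q) ℂ := NormedSpace.exp (t • A)

theorem matExp_zero : matExp A 0 = 1 := by simp [matExp]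

theorem matExp_add (s t : ℝ) : matExp A (s + t) = matExp A s * matExp A t := by
  rw [matExp, add_smul, Matrix.exp_add_of_commute _ _ (((Commute.refl A).smul_left s).smul_right t)]
  rfl

theorem matExp_mul_neg (t : ℝ) : matExp A t * matExp A (-t) = 1 := by
  rw [← matExp_add, add_neg_cancel, matExp_zero]

theorem matExp_neg_mul (t : ℝ) : matExp A (-t) * matExp A t = 1 := by
  rw [← matExp_add, neg_add_cancel, matExp_zero]

section
attribute [local instance] Matrix.linftyOpNormedRing Matrix.linftyOpNormedAlgebra

/-- The derivative of `e^{tA}` with the factor `A` on the left. -/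
theorem hasMatDeriv_matExp' (t : ℝ) : HasMatDeriv (matExp A) (A * matExp A t) t := by
  have h := hasDerivAt_exp_smul_const' (𝕂 := ℝ) A t
  intro i j
  exact (Matrix.entryLinearMap ℝ ℂ i j).toContinuousLinearMap.hasFDerivAt.comp_hasDerivAt t h

/-- The derivative of `e^{tA}` with the factor `A` on the right. -/
theorem hasMatDeriv_matExp (t : ℝ) : HasMatDeriv (matExp A) (matExp A t * A) t := by
  have h := hasDerivAt_exp_smul_const (𝕂 := ℝ) A t
  intro i j
  exact (Matrix.entryLinearMap ℝ ℂ i j).toContinuousLinearMap.hasFDerivAt.comp_hasDerivAt t h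

theorem map_ofReal_exp (M : Matrix (Fin q) (Fin q) ℝ) (t : ℝ) :
    (NormedSpace.exp (t • M)).map Complex.ofReal = matExp (M.map Complex.ofReal) t := by
  have h := NormedSpace.map_exp (Complex.ofRealHom.mapMatrix (m := Fin q))
    (Continuous.matrix_map continuous_id Complex.continuous_ofReal) (t • M)
  refine h.trans ?_
  rw [matExp]
  congr 1
  ext i j
  simp
end

theorem hasMatDeriv_matExp_neg (t : ℝ) :
    HasMatDeriv (fun s => matExp A (-s)) (-(matExp A (-t) * A)) t := by
  have h := HasMatDeriv.comp_const_sub (c := 0) (τ := t) (hasMatDeriv_matExp A (0 - t))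
  simpa using h

theorem eq_zero_of_mul_matExp {p : ℕ} {M : Matrix (Fin p) (Fin q) ℂ} {t : ℝ}
    (h : M * matExp A t = 0) : M = 0 := by
  rw [← Matrix.mul_one M, ← matExp_mul_neg A t, ← Matrix.mul_assoc, h, Matrix.zero_mul]

end MatrixExp

/-! ### The homogeneous ODEc over the complex numbers and its reflection symmetry -/

/-- The coefficients of the ODEc over `ℂ`, with the names of the delay system. -/
structure ComplexCoeffs (n d : ℕ) where
  h : ℝ
  A₀ : Matrix (Fin n) (Fin n) ℂ
  A₁ : Matrix (Fin n) (Fin n) ℂ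
  C : Matrix (Fin n) (Fin d) ℂ
  A : Matrix (Fin d) (Fin d) ℂ
  B : Matrix (Fin d) (Fin n) ℂ

/-- Six complex matrix-valued functions `(Ω₁, …, Ω₆)` of a real variable. They are bundled as a
nested product so that they carry the structure of a complex vector space. -/
abbrev ComplexUnknowns (n d : ℕ) : Type :=
  (ℝ → Matrix (Fin n) (Fin n) ℂ) × (ℝ → Matrix (Fin n) (Fin n) ℂ) ×
  (ℝ → Matrix (Fin n) (Fin d) ℂ) × (ℝ → Matrix (Fin n) (Fin d) ℂ) ×
  (ℝ → Matrix (Fin d) (Fin n) ℂ) × (ℝ → Matrix (Fin d) (Fin n) ℂ)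

namespace ComplexUnknowns

variable {n d : ℕ} (Ω : ComplexUnknowns n d)

abbrev Ω₁ : ℝ → Matrix (Fin n) (Fin n) ℂ := Ω.1
abbrev Ω₂ : ℝ → Matrix (Fin n) (Fin n) ℂ := Ω.2.1
abbrev Ω₃ : ℝ → Matrix (Fin n) (Fin d) ℂ := Ω.2.2.1
abbrev Ω₄ : ℝ → Matrix (Fin n) (Fin d) ℂ := Ω.2.2.2.1
abbrev Ω₅ : ℝ → Matrix (Fin d) (Fin n) ℂ := Ω.2.2.2.2.1
abbrev Ω₆ : ℝ → Matrix (Fin d) (Fin n) ℂ := Ω.2.2.2.2.2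

section mk

variable (F₁ F₂ : ℝ → Matrix (Fin n) (Fin n) ℂ) (F₃ F₄ : ℝ → Matrix (Fin n) (Fin d) ℂ)
  (F₅ F₆ : ℝ → Matrix (Fin d) (Fin n) ℂ)

@[simp] theorem mk_Ω₁ : Ω₁ (F₁, F₂, F₃, F₄, F₅, F₆) = F₁ := rfl
@[simp] theorem mk_Ω₂ : Ω₂ (F₁, F₂, F₃, F₄, F₅, F₆) = F₂ := rfl
@[simp] theorem mk_Ω₃ : Ω₃ (F₁, F₂, F₃, F₄, F₅, F₆) = F₃ := rfl
@[simp] theorem mk_Ω₄ : Ω₄ (F₁, F₂, F₃, F₄, F₅, F₆) = F₄ := rfl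
@[simp] theorem mk_Ω₅ : Ω₅ (F₁, F₂, F₃, F₄, F₅, F₆) = F₅ := rfl
@[simp] theorem mk_Ω₆ : Ω₆ (F₁, F₂, F₃, F₄, F₅, F₆) = F₆ := rfl

end mk

variable (Θ : ComplexUnknowns n d) (c : ℂ) (t : ℝ)

@[simp] theorem zero_Ω₁ : (0 : ComplexUnknowns n d).Ω₁ t = 0 := rfl
@[simp] theorem zero_Ω₂ : (0 : ComplexUnknowns n d).Ω₂ t = 0 := rfl
@[simp] theorem zero_Ω₃ : (0 : ComplexUnknowns n d).Ω₃ t = 0 := rfl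
@[simp] theorem zero_Ω₄ : (0 : ComplexUnknowns n d).Ω₄ t = 0 := rfl
@[simp] theorem zero_Ω₅ : (0 : ComplexUnknowns n d).Ω₅ t = 0 := rfl
@[simp] theorem zero_Ω₆ : (0 : ComplexUnknowns n d).Ω₆ t = 0 := rfl
@[simp] theorem add_Ω₁ : (Ω + Θ).Ω₁ t = Ω.Ω₁ t + Θ.Ω₁ t := rfl
@[simp] theorem add_Ω₂ : (Ω + Θ).Ω₂ t = Ω.Ω₂ t + Θ.Ω₂ t := rfl
@[simp] theorem add_Ω₃ : (Ω + Θ).Ω₃ t = Ω.Ω₃ t + Θ.Ω₃ t := rfl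
@[simp] theorem add_Ω₄ : (Ω + Θ).Ω₄ t = Ω.Ω₄ t + Θ.Ω₄ t := rfl
@[simp] theorem add_Ω₅ : (Ω + Θ).Ω₅ t = Ω.Ω₅ t + Θ.Ω₅ t := rfl
@[simp] theorem add_Ω₆ : (Ω + Θ).Ω₆ t = Ω.Ω₆ t + Θ.Ω₆ t := rfl
@[simp] theorem smul_Ω₁ : (c • Ω).Ω₁ t = c • Ω.Ω₁ t := rfl
@[simp] theorem smul_Ω₂ : (c • Ω).Ω₂ t = c • Ω.Ω₂ t := rfl
@[simp] theorem smul_Ω₃ : (c • Ω).Ω₃ t = c • Ω.Ω₃ t := rfl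
@[simp] theorem smul_Ω₄ : (c • Ω).Ω₄ t = c • Ω.Ω₄ t := rfl
@[simp] theorem smul_Ω₅ : (c • Ω).Ω₅ t = c • Ω.Ω₅ t := rfl
@[simp] theorem smul_Ω₆ : (c • Ω).Ω₆ t = c • Ω.Ω₆ t := rfl

variable {Ω Θ} in
theorem ext_apply (h₁ : ∀ t, Ω.Ω₁ t = Θ.Ω₁ t) (h₂ : ∀ t, Ω.Ω₂ t = Θ.Ω₂ t)
    (h₃ : ∀ t, Ω.Ω₃ t = Θ.Ω₃ t) (h₄ : ∀ t, Ω.Ω₄ t = Θ.Ω₄ t) (h₅ : ∀ t, Ω.Ω₅ t = Θ.Ω₅ t)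
    (h₆ : ∀ t, Ω.Ω₆ t = Θ.Ω₆ t) : Ω = Θ :=
  Prod.ext (funext h₁) (Prod.ext (funext h₂) (Prod.ext (funext h₃) (Prod.ext (funext h₄)
    (Prod.ext (funext h₅) (funext h₆)))))

/-- The time reversal with transposition that is a symmetry of the homogeneous ODEc. -/
def reflect (h : ℝ) : ComplexUnknowns n d :=
  (fun t => (Ω.Ω₂ (h - t))ᵀ, fun t => (Ω.Ω₁ (h - t))ᵀ, fun t => (Ω.Ω₆ (h - t))ᵀ,
    fun t => (Ω.Ω₅ (h - t))ᵀ, fun t => (Ω.Ω₄ (h - t))ᵀ, fun t => (Ω.Ω₃ (h - t))ᵀ)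

variable (h : ℝ)

@[simp] theorem reflect_Ω₁ : (Ω.reflect h).Ω₁ t = (Ω.Ω₂ (h - t))ᵀ := rfl
@[simp] theorem reflect_Ω₂ : (Ω.reflect h).Ω₂ t = (Ω.Ω₁ (h - t))ᵀ := rfl
@[simp] theorem reflect_Ω₃ : (Ω.reflect h).Ω₃ t = (Ω.Ω₆ (h - t))ᵀ := rfl
@[simp] theorem reflect_Ω₄ : (Ω.reflect h).Ω₄ t = (Ω.Ω₅ (h - t))ᵀ := rfl
@[simp] theorem reflect_Ω₅ : (Ω.reflect h).Ω₅ t = (Ω.Ω₄ (h - t))ᵀ := rfl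
@[simp] theorem reflect_Ω₆ : (Ω.reflect h).Ω₆ t = (Ω.Ω₃ (h - t))ᵀ := rfl

end ComplexUnknowns

namespace ComplexCoeffs

variable {n d : ℕ} (T : ComplexCoeffs n d)

/-- The constant matrix `C e^{-hA}`. -/
def Ch : Matrix (Fin n) (Fin d) ℂ := T.C * matExp T.A (-T.h)

/-- `Ω` solves the ODEc over `ℂ` with right-hand side `Q = 0`. -/
structure IsHomogeneousSolution (Ω : ComplexUnknowns n d) : Prop where
  deriv₁ : ∀ τ, HasMatDeriv Ω.Ω₁
    (Ω.Ω₁ τ * T.A₀ + Ω.Ω₂ τ * T.A₁ + Ω.Ω₃ τ * T.B + Ω.Ω₄ τ * T.B) τ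
  deriv₂ : ∀ τ, HasMatDeriv Ω.Ω₂
    (-(T.A₁ᵀ * Ω.Ω₁ τ) - T.A₀ᵀ * Ω.Ω₂ τ - T.Bᵀ * Ω.Ω₅ τ - T.Bᵀ * Ω.Ω₆ τ) τ
  deriv₃ : ∀ τ, HasMatDeriv Ω.Ω₃ (-(Ω.Ω₃ τ * T.A) + Ω.Ω₁ τ * T.C) τ
  deriv₄ : ∀ τ, HasMatDeriv Ω.Ω₄ (-(Ω.Ω₄ τ * T.A) - Ω.Ω₂ τ * T.Ch) τ
  deriv₅ : ∀ τ, HasMatDeriv Ω.Ω₅ (T.Aᵀ * Ω.Ω₅ τ + T.Chᵀ * Ω.Ω₁ τ) τ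
  deriv₆ : ∀ τ, HasMatDeriv Ω.Ω₆ (T.Aᵀ * Ω.Ω₆ τ - T.Cᵀ * Ω.Ω₂ τ) τ
  algebraic : Ω.Ω₁ 0 * T.A₀ + Ω.Ω₂ 0 * T.A₁ + Ω.Ω₄ 0 * T.B
    + T.A₁ᵀ * Ω.Ω₁ T.h + T.A₀ᵀ * Ω.Ω₂ T.h + T.Bᵀ * Ω.Ω₅ T.h = 0
  boundary₁₂ : Ω.Ω₁ 0 = Ω.Ω₂ T.h
  boundary₃ : Ω.Ω₃ 0 = 0
  boundary₄ : Ω.Ω₄ T.h = 0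
  boundary₅ : Ω.Ω₅ 0 = 0
  boundary₆ : Ω.Ω₆ T.h = 0

variable {T} {Ω : ComplexUnknowns n d}

/-- Reflection exchanges the first two differential equations, the third with the sixth, and the
fourth with the fifth, and permutes the boundary conditions accordingly. -/
theorem IsHomogeneousSolution.reflect (hΩ : T.IsHomogeneousSolution Ω) :
    T.IsHomogeneousSolution (Ω.reflect T.h) where
  deriv₁ τ := (hΩ.deriv₂ (T.h - τ)).comp_const_sub.transpose.congr_deriv (by
    simp; abel)
  deriv₂ τ := (hΩ.deriv₁ (T.h - τ)).comp_const_sub.transpose.congr_deriv (by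
    simp; abel)
  deriv₃ τ := (hΩ.deriv₆ (T.h - τ)).comp_const_sub.transpose.congr_deriv (by
    simp; abel)
  deriv₄ τ := (hΩ.deriv₅ (T.h - τ)).comp_const_sub.transpose.congr_deriv (by
    simp; abel)
  deriv₅ τ := (hΩ.deriv₄ (T.h - τ)).comp_const_sub.transpose.congr_deriv (by
    simp; abel)
  deriv₆ τ := (hΩ.deriv₃ (T.h - τ)).comp_const_sub.transpose.congr_deriv (by
    simp; abel)
  algebraic := by
    have h := congrArg Matrix.transpose hΩ.algebraic
    simp only [Matrix.transpose_add, Matrix.transpose_mul, Matrix.transpose_transpose,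
      Matrix.transpose_zero] at h
    simp only [ComplexUnknowns.reflect_Ω₁, ComplexUnknowns.reflect_Ω₂,
      ComplexUnknowns.reflect_Ω₄, ComplexUnknowns.reflect_Ω₅, sub_zero, sub_self]
    rw [← h]
    abel
  boundary₁₂ := by simp [hΩ.boundary₁₂]
  boundary₃ := by simp [hΩ.boundary₆]
  boundary₄ := by simp [hΩ.boundary₅]
  boundary₅ := by simp [hΩ.boundary₄]
  boundary₆ := by simp [hΩ.boundary₃]

/-- The forward convolution `R` of `Ω₅` with `s ↦ C e^{-sA}` is also a convolution of `Ω₃`. This is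
the exchange of the order of integration in the double integral of `Ω₁` hidden in `R`, obtained
from the differential equations alone. -/
theorem IsHomogeneousSolution.exists_forward_convolution (hΩ : T.IsHomogeneousSolution Ω) :
    ∃ R : ℝ → Matrix (Fin d) (Fin d) ℂ, R 0 = 0 ∧
      (∀ t, HasMatDeriv R (-(R t * T.A) + Ω.Ω₅ t * T.C) t) ∧
      ∀ t, HasMatDeriv R (T.Aᵀ * R t + T.Chᵀ * Ω.Ω₃ t) t := by
  obtain ⟨H, hH0, hH⟩ := HasMatDeriv.exists_primitive
    (F := fun t => Ω.Ω₅ t * T.C * matExp T.A t) (HasMatDeriv.continuous_entry fun t =>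
      ((hΩ.deriv₅ t).mul_const T.C).mul (hasMatDeriv_matExp T.A t))
  let R := fun t => H t * matExp T.A (-t)
  have hR : ∀ t, HasMatDeriv R (-(R t * T.A) + Ω.Ω₅ t * T.C) t := fun t =>
    ((hH t).mul (hasMatDeriv_matExp_neg T.A t)).congr_deriv (by
      simp only [R, Matrix.mul_assoc, matExp_mul_neg, Matrix.mul_one, Matrix.mul_neg]
      abel)
  have hR0 : R 0 = 0 := by simp [R, hH0]
  -- The defect `E` of the second equation satisfies `E' = -E A` and `E 0 = 0`.
  let E := fun t => -(R t * T.A) + Ω.Ω₅ t * T.C - T.Aᵀ * R t - T.Chᵀ * Ω.Ω₃ t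
  have hE : ∀ t, HasMatDeriv E (-(E t * T.A)) t := fun t =>
    ((((((hR t).mul_const T.A).neg).add ((hΩ.deriv₅ t).mul_const T.C)).sub
      ((hR t).const_mul T.Aᵀ)).sub ((hΩ.deriv₃ t).const_mul T.Chᵀ)).congr_deriv (by
      simp only [E, Matrix.mul_add, Matrix.add_mul, Matrix.sub_mul, Matrix.mul_neg,
        Matrix.neg_mul, Matrix.mul_assoc]
      abel)
  have hE0 : E 0 = 0 := by simp [E, hR0, hΩ.boundary₃, hΩ.boundary₅]
  have hEt : ∀ t, E t = 0 := fun t => by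
    refine eq_zero_of_mul_matExp T.A (t := t) ?_
    rw [HasMatDeriv.eq_of_forall_zero (F := fun t => E t * matExp T.A t) (fun s =>
      ((hE s).mul (hasMatDeriv_matExp' T.A s)).congr_deriv (by simp [Matrix.mul_assoc])) t 0]
    simp [hE0]
  refine ⟨R, hR0, hR, fun t => (hR t).congr_deriv ?_⟩
  rw [← sub_eq_zero, ← hEt t]
  simp only [E]
  abel

/-- The backward counterpart of `exists_forward_convolution`. -/
theorem IsHomogeneousSolution.exists_backward_convolution (hΩ : T.IsHomogeneousSolution Ω) :
    ∃ S : ℝ → Matrix (Fin d) (Fin d) ℂ, S T.h = 0 ∧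
      (∀ t, HasMatDeriv S (-(S t * T.A) - Ω.Ω₆ t * T.Ch) t) ∧
      ∀ t, HasMatDeriv S (T.Aᵀ * S t - T.Cᵀ * Ω.Ω₄ t) t := by
  obtain ⟨R, hR0, hR, hR'⟩ := hΩ.reflect.exists_forward_convolution
  refine ⟨fun t => (R (T.h - t))ᵀ, by simp [hR0], fun t => ?_, fun t => ?_⟩
  · exact (hR' (T.h - t)).comp_const_sub.transpose.congr_deriv (by
      simp; abel)
  · exact (hR (T.h - t)).comp_const_sub.transpose.congr_deriv (by
      simp; abel)

/-- The function `Ω₂ C e^{(t-h)A}` differs by a constant from a combination of convolutions;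
comparing `t = 0` with `t = h` expresses boundary values of the solution by `R h + S 0`. -/
theorem IsHomogeneousSolution.boundary_identity (hΩ : T.IsHomogeneousSolution Ω)
    {R S : ℝ → Matrix (Fin d) (Fin d) ℂ} (hR0 : R 0 = 0) (hSh : S T.h = 0)
    (hR : ∀ t, HasMatDeriv R (-(R t * T.A) + Ω.Ω₅ t * T.C) t)
    (hS : ∀ t, HasMatDeriv S (-(S t * T.A) - Ω.Ω₆ t * T.Ch) t) :
    T.A₀ᵀ * Ω.Ω₄ 0 + T.A₁ᵀ * Ω.Ω₃ T.h + Ω.Ω₁ 0 * T.C - Ω.Ω₄ 0 * T.A - Ω.Ω₂ 0 * T.Ch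
      = -(T.Bᵀ * (R T.h + S 0)) := by
  -- `e` is the weight `e^{(t-h)A}`, which equals `1` at `h` and turns `C` into `Ch` at `0`.
  let e := fun t => matExp T.A (-T.h + t)
  have he : ∀ t, HasMatDeriv e (e t * T.A) t := fun t =>
    (hasMatDeriv_matExp T.A (-T.h + t)).comp_const_add
  have he' : ∀ t, e t * T.A = T.A * e t := fun t =>
    (hasMatDeriv_matExp T.A _).unique (hasMatDeriv_matExp' T.A _)
  have hCe : ∀ t, T.Ch * matExp T.A t = T.C * e t := fun t => by
    simp only [Ch, e, matExp_add, Matrix.mul_assoc]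
  have hx' : ∀ t, matExp T.A t * T.A = T.A * matExp T.A t := fun t =>
    (hasMatDeriv_matExp T.A _).unique (hasMatDeriv_matExp' T.A _)
  have h₂ := fun t => ((hΩ.deriv₂ t).mul_const T.C).mul (he t)
  have h₃ := fun t => (((hΩ.deriv₃ t).mul (he t)).const_mul T.A₁ᵀ)
  have h₄ := fun t => (hΩ.deriv₄ t).mul (hasMatDeriv_matExp T.A t)
  have h₅ := fun t => ((hR t).mul (he t)).const_mul T.Bᵀ
  have h₆ := fun t => ((hS t).mul (hasMatDeriv_matExp T.A t)).const_mul T.Bᵀ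
  have key := HasMatDeriv.eq_of_forall_zero (fun t => ((((((h₂ t).add (h₃ t)).sub
    ((h₄ t).const_mul T.A₀ᵀ)).add (h₅ t)).sub (h₆ t)).add ((h₄ t).mul_const T.A)).congr_deriv (by
      simp only [Matrix.mul_add, Matrix.add_mul, Matrix.sub_mul, Matrix.mul_sub, Matrix.mul_neg,
        Matrix.neg_mul, Matrix.mul_assoc, hCe, he', hx']
      abel)) 0 T.h
  have e0 : T.C * e 0 = T.Ch := by simp [e, Ch]
  have eh : e T.h = 1 := by simp [e, matExp_zero]
  simp only [hR0, hSh, hΩ.boundary₃, hΩ.boundary₄, eh, matExp_zero, Matrix.zero_mul,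
    Matrix.mul_zero, Matrix.mul_one, Matrix.mul_assoc, e0, add_zero, sub_zero,
    ← hΩ.boundary₁₂] at key
  rw [← sub_eq_zero] at key ⊢
  rw [← neg_eq_zero, ← key, Matrix.mul_add]
  abel

end ComplexCoeffs

/-! ### The infinitesimal time shift -/

namespace ComplexCoeffs

variable {n d : ℕ} (T : ComplexCoeffs n d)

/-- The infinitesimal time shift. On `Ω₁`, `Ω₂` and the sums `Ω₃ + Ω₄`, `Ω₅ + Ω₆`, which alone enter
the first two equations, it is differentiation along a solution; the exponential corrections, which
cancel in the sums, restore the boundary conditions on `Ω₃, …, Ω₆`. -/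
def shift (Ω : ComplexUnknowns n d) : ComplexUnknowns n d :=
  (fun t => Ω.Ω₁ t * T.A₀ + Ω.Ω₂ t * T.A₁ + Ω.Ω₃ t * T.B + Ω.Ω₄ t * T.B,
    fun t => -(T.A₁ᵀ * Ω.Ω₁ t) - T.A₀ᵀ * Ω.Ω₂ t - T.Bᵀ * Ω.Ω₅ t - T.Bᵀ * Ω.Ω₆ t,
    fun t => -(Ω.Ω₃ t * T.A) + Ω.Ω₁ t * T.C - Ω.Ω₁ 0 * T.C * matExp T.A (-t),
    fun t => -(Ω.Ω₄ t * T.A) - Ω.Ω₂ t * T.Ch + Ω.Ω₁ 0 * T.C * matExp T.A (-t),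
    fun t => T.Aᵀ * Ω.Ω₅ t + T.Chᵀ * Ω.Ω₁ t - (matExp T.A t)ᵀ * (T.Chᵀ * Ω.Ω₁ 0),
    fun t => T.Aᵀ * Ω.Ω₆ t - T.Cᵀ * Ω.Ω₂ t + (matExp T.A t)ᵀ * (T.Chᵀ * Ω.Ω₁ 0))

section shift_apply

variable (Ω : ComplexUnknowns n d) (t : ℝ)

theorem shift_Ω₁ : (T.shift Ω).Ω₁ t =
    Ω.Ω₁ t * T.A₀ + Ω.Ω₂ t * T.A₁ + Ω.Ω₃ t * T.B + Ω.Ω₄ t * T.B := rfl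
theorem shift_Ω₂ : (T.shift Ω).Ω₂ t =
    -(T.A₁ᵀ * Ω.Ω₁ t) - T.A₀ᵀ * Ω.Ω₂ t - T.Bᵀ * Ω.Ω₅ t - T.Bᵀ * Ω.Ω₆ t := rfl
theorem shift_Ω₃ : (T.shift Ω).Ω₃ t =
    -(Ω.Ω₃ t * T.A) + Ω.Ω₁ t * T.C - Ω.Ω₁ 0 * T.C * matExp T.A (-t) := rfl
theorem shift_Ω₄ : (T.shift Ω).Ω₄ t =
    -(Ω.Ω₄ t * T.A) - Ω.Ω₂ t * T.Ch + Ω.Ω₁ 0 * T.C * matExp T.A (-t) := rfl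
theorem shift_Ω₅ : (T.shift Ω).Ω₅ t =
    T.Aᵀ * Ω.Ω₅ t + T.Chᵀ * Ω.Ω₁ t - (matExp T.A t)ᵀ * (T.Chᵀ * Ω.Ω₁ 0) := rfl
theorem shift_Ω₆ : (T.shift Ω).Ω₆ t =
    T.Aᵀ * Ω.Ω₆ t - T.Cᵀ * Ω.Ω₂ t + (matExp T.A t)ᵀ * (T.Chᵀ * Ω.Ω₁ 0) := rfl

end shift_apply

variable {T} {Ω : ComplexUnknowns n d}

/-- The time shift preserves the algebraic boundary condition. Modulo the differential equations
and the other boundary conditions, the left-hand side is a difference of two copies of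
`Bᵀ (R h + S 0) B`, one from `boundary_identity` for `Ω` and one from `boundary_identity` for the
reflected solution. -/
theorem IsHomogeneousSolution.algebraic_shift (hΩ : T.IsHomogeneousSolution Ω) :
    (T.shift Ω).Ω₁ 0 * T.A₀ + (T.shift Ω).Ω₂ 0 * T.A₁ + (T.shift Ω).Ω₄ 0 * T.B
      + T.A₁ᵀ * (T.shift Ω).Ω₁ T.h + T.A₀ᵀ * (T.shift Ω).Ω₂ T.h
      + T.Bᵀ * (T.shift Ω).Ω₅ T.h = 0 := by
  obtain ⟨R, hR0, hR, hR'⟩ := hΩ.exists_forward_convolution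
  obtain ⟨S, hSh, hS, hS'⟩ := hΩ.exists_backward_convolution
  have h₁ := hΩ.boundary_identity hR0 hSh hR hS
  have h₂ := hΩ.reflect.boundary_identity (R := fun t => (S (T.h - t))ᵀ)
    (S := fun t => (R (T.h - t))ᵀ) (by simp [hSh]) (by simp [hR0])
    (fun t => (hS' (T.h - t)).comp_const_sub.transpose.congr_deriv (by simp; abel))
    (fun t => (hR' (T.h - t)).comp_const_sub.transpose.congr_deriv (by simp; abel))
  have h₂ := congrArg Matrix.transpose h₂
  simp only [ComplexUnknowns.reflect_Ω₁, ComplexUnknowns.reflect_Ω₂, ComplexUnknowns.reflect_Ω₃,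
    ComplexUnknowns.reflect_Ω₄, Matrix.transpose_add, Matrix.transpose_sub, Matrix.transpose_neg,
    Matrix.transpose_mul, Matrix.transpose_transpose, sub_zero, sub_self] at h₂
  have h₁ := congrArg (· * T.B) h₁
  have h₂ := congrArg (T.Bᵀ * ·) h₂
  have h₃ := congrArg (· * T.A₀) hΩ.algebraic
  have h₄ := congrArg (T.A₀ᵀ * ·) hΩ.algebraic
  have hx : (matExp T.A T.h)ᵀ * T.Chᵀ = T.Cᵀ := by
    rw [← Matrix.transpose_mul, Ch, Matrix.mul_assoc, matExp_neg_mul, Matrix.mul_one]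
  simp only [shift_Ω₁, shift_Ω₂, shift_Ω₄, shift_Ω₅, hΩ.boundary₃, hΩ.boundary₄, hΩ.boundary₅,
    hΩ.boundary₆, ← hΩ.boundary₁₂, matExp_zero, neg_zero, Matrix.mul_add, Matrix.add_mul,
    Matrix.sub_mul, Matrix.mul_sub, Matrix.mul_neg, Matrix.neg_mul, Matrix.mul_assoc,
    Matrix.mul_zero, Matrix.zero_mul, Matrix.mul_one, add_zero, sub_zero] at h₁ h₂ h₃ h₄ ⊢
  rw [← Matrix.mul_assoc (matExp T.A T.h)ᵀ, hx]
  -- Subtracting `h₁` and `h₂` cancels the convolutions. Subtracting `h₃` and `h₄` uses the algebraic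
  -- condition on `Ω` to eliminate the products of `A₀` with boundary values.
  have h₅ := congrArg₂ (· - ·) h₁ h₂
  have h₆ := congrArg₂ (· - ·) h₃ h₄
  rw [← sub_eq_zero] at h₅ h₆
  rw [← add_zero (0 : Matrix (Fin n) (Fin n) ℂ)]
  nth_rw 1 [← h₅]
  rw [← h₆]
  abel

theorem IsHomogeneousSolution.shift (hΩ : T.IsHomogeneousSolution Ω) :
    T.IsHomogeneousSolution (T.shift Ω) where
  deriv₁ τ := (((((hΩ.deriv₁ τ).mul_const T.A₀).add ((hΩ.deriv₂ τ).mul_const T.A₁)).add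
    ((hΩ.deriv₃ τ).mul_const T.B)).add ((hΩ.deriv₄ τ).mul_const T.B)).congr_deriv (by
      simp only [shift_Ω₁, shift_Ω₂, shift_Ω₃, shift_Ω₄, Matrix.add_mul, Matrix.sub_mul]
      abel)
  deriv₂ τ := (((((hΩ.deriv₁ τ).const_mul T.A₁ᵀ).neg.sub ((hΩ.deriv₂ τ).const_mul T.A₀ᵀ)).sub
    ((hΩ.deriv₅ τ).const_mul T.Bᵀ)).sub ((hΩ.deriv₆ τ).const_mul T.Bᵀ)).congr_deriv (by
      simp only [shift_Ω₁, shift_Ω₂, shift_Ω₅, shift_Ω₆, Matrix.mul_add, Matrix.mul_sub]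
      abel)
  deriv₃ τ := ((((hΩ.deriv₃ τ).mul_const T.A).neg.add ((hΩ.deriv₁ τ).mul_const T.C)).sub
    ((hasMatDeriv_matExp_neg T.A τ).const_mul _)).congr_deriv (by
      simp only [shift_Ω₁, shift_Ω₃, Matrix.add_mul, Matrix.sub_mul, Matrix.mul_neg,
        Matrix.mul_assoc]
      abel)
  deriv₄ τ := ((((hΩ.deriv₄ τ).mul_const T.A).neg.sub ((hΩ.deriv₂ τ).mul_const T.Ch)).add
    ((hasMatDeriv_matExp_neg T.A τ).const_mul _)).congr_deriv (by
      simp only [shift_Ω₂, shift_Ω₄, Matrix.add_mul, Matrix.sub_mul, Matrix.mul_neg,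
        Matrix.mul_assoc]
      abel)
  deriv₅ τ := ((((hΩ.deriv₅ τ).const_mul T.Aᵀ).add ((hΩ.deriv₁ τ).const_mul T.Chᵀ)).sub
    ((hasMatDeriv_matExp T.A τ).transpose.mul_const _)).congr_deriv (by
      simp only [shift_Ω₁, shift_Ω₅, Matrix.mul_add, Matrix.mul_sub, Matrix.transpose_mul,
        Matrix.mul_assoc]
      abel)
  deriv₆ τ := ((((hΩ.deriv₆ τ).const_mul T.Aᵀ).sub ((hΩ.deriv₂ τ).const_mul T.Cᵀ)).add
    ((hasMatDeriv_matExp T.A τ).transpose.mul_const _)).congr_deriv (by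
      simp only [shift_Ω₂, shift_Ω₆, Matrix.mul_add, Matrix.mul_sub, Matrix.transpose_mul,
        Matrix.mul_assoc]
      abel)
  algebraic := hΩ.algebraic_shift
  boundary₁₂ := by
    simp only [shift_Ω₁, shift_Ω₂, hΩ.boundary₃, hΩ.boundary₆]
    rw [← sub_eq_zero, ← hΩ.algebraic]
    simp only [Matrix.zero_mul, Matrix.mul_zero]
    abel
  boundary₃ := by simp [shift_Ω₃, hΩ.boundary₃, matExp_zero]
  boundary₄ := by simp [shift_Ω₄, hΩ.boundary₄, hΩ.boundary₁₂, Ch, Matrix.mul_assoc]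
  boundary₅ := by simp [shift_Ω₅, hΩ.boundary₅, matExp_zero]
  boundary₆ := by
    have hx : (matExp T.A T.h)ᵀ * T.Chᵀ = T.Cᵀ := by
      rw [← Matrix.transpose_mul, Ch, Matrix.mul_assoc, matExp_neg_mul, Matrix.mul_one]
    simp [shift_Ω₆, hΩ.boundary₆, hΩ.boundary₁₂, ← Matrix.mul_assoc, hx]

variable (T)

/-- The complex vector space of the solutions of the homogeneous ODEc. -/
def homogeneousSolutions : Submodule ℂ (ComplexUnknowns n d) where
  carrier := {Ω | T.IsHomogeneousSolution Ω}
  zero_mem' := by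
    constructor <;> intros <;>
      first
        | exact (HasMatDeriv.const _).congr_deriv (by simp)
        | simp
  add_mem' {Ω Θ} hΩ hΘ :=
    { deriv₁ := fun τ => ((hΩ.deriv₁ τ).add (hΘ.deriv₁ τ)).congr_deriv (by
        simp [Matrix.add_mul]; abel)
      deriv₂ := fun τ => ((hΩ.deriv₂ τ).add (hΘ.deriv₂ τ)).congr_deriv (by
        simp [Matrix.mul_add]; abel)
      deriv₃ := fun τ => ((hΩ.deriv₃ τ).add (hΘ.deriv₃ τ)).congr_deriv (by
        simp [Matrix.add_mul]; abel)
      deriv₄ := fun τ => ((hΩ.deriv₄ τ).add (hΘ.deriv₄ τ)).congr_deriv (by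
        simp [Matrix.add_mul]; abel)
      deriv₅ := fun τ => ((hΩ.deriv₅ τ).add (hΘ.deriv₅ τ)).congr_deriv (by
        simp [Matrix.mul_add]; abel)
      deriv₆ := fun τ => ((hΩ.deriv₆ τ).add (hΘ.deriv₆ τ)).congr_deriv (by
        simp [Matrix.mul_add]; abel)
      algebraic := by
        rw [← add_zero (0 : Matrix (Fin n) (Fin n) ℂ)]
        nth_rw 1 [← hΩ.algebraic]
        rw [← hΘ.algebraic]
        simp [Matrix.mul_add, Matrix.add_mul]
        abel
      boundary₁₂ := congrArg₂ (· + ·) hΩ.boundary₁₂ hΘ.boundary₁₂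
      boundary₃ := by simp [hΩ.boundary₃, hΘ.boundary₃]
      boundary₄ := by simp [hΩ.boundary₄, hΘ.boundary₄]
      boundary₅ := by simp [hΩ.boundary₅, hΘ.boundary₅]
      boundary₆ := by simp [hΩ.boundary₆, hΘ.boundary₆] }
  smul_mem' c Ω hΩ :=
    { deriv₁ := fun τ => ((hΩ.deriv₁ τ).const_smul c).congr_deriv (by simp)
      deriv₂ := fun τ => ((hΩ.deriv₂ τ).const_smul c).congr_deriv (by simp [smul_sub])
      deriv₃ := fun τ => ((hΩ.deriv₃ τ).const_smul c).congr_deriv (by simp)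
      deriv₄ := fun τ => ((hΩ.deriv₄ τ).const_smul c).congr_deriv (by simp [smul_sub])
      deriv₅ := fun τ => ((hΩ.deriv₅ τ).const_smul c).congr_deriv (by simp)
      deriv₆ := fun τ => ((hΩ.deriv₆ τ).const_smul c).congr_deriv (by simp [smul_sub])
      algebraic := by
        simpa using congrArg (c • ·) hΩ.algebraic
      boundary₁₂ := congrArg (c • ·) hΩ.boundary₁₂
      boundary₃ := by simp [hΩ.boundary₃]
      boundary₄ := by simp [hΩ.boundary₄]
      boundary₅ := by simp [hΩ.boundary₅]
      boundary₆ := by simp [hΩ.boundary₆] }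

/-- The time shift as an endomorphism of the space of homogeneous solutions. -/
def shiftEnd : Module.End ℂ T.homogeneousSolutions where
  toFun Ω := ⟨T.shift Ω.1, Ω.2.shift⟩
  map_add' Ω Θ := by
    apply Subtype.ext
    apply ComplexUnknowns.ext_apply <;> intro t <;>
      simp [shift_Ω₁, shift_Ω₂, shift_Ω₃, shift_Ω₄, shift_Ω₅, shift_Ω₆, Matrix.add_mul,
        Matrix.mul_add] <;> abel
  map_smul' c Ω := by
    apply Subtype.ext
    apply ComplexUnknowns.ext_apply <;> intro t <;>
      simp [shift_Ω₁, shift_Ω₂, shift_Ω₃, shift_Ω₄, shift_Ω₅, shift_Ω₆, smul_add, smul_sub]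

end ComplexCoeffs

/-! ### Exponential solutions and the characteristic matrix -/

theorem HasMatDeriv.integral_eq_sub {p q : ℕ} {F F' : ℝ → Matrix (Fin p) (Fin q) ℂ}
    (hF : ∀ t, HasMatDeriv F (F' t) t) (hc : ∀ i j, Continuous fun t => F' t i j) (a b : ℝ)
    (i : Fin p) (j : Fin q) : ∫ t in a..b, F' t i j = (F b - F a) i j :=
  intervalIntegral.integral_eq_sub_of_hasDerivAt (fun t _ => hF t i j)
    ((hc i j).intervalIntegrable _ _)

theorem hasDerivAt_cexp_ofReal (lam : ℂ) (c t : ℝ) :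
    HasDerivAt (fun t : ℝ => Complex.exp (lam * ((t + c : ℝ) : ℂ)))
      (lam * Complex.exp (lam * ((t + c : ℝ) : ℂ))) t := by
  have h := (((hasDerivAt_id t).add_const c).ofReal_comp.const_mul lam).cexp
  simpa [mul_comm] using h

theorem HasMatDeriv.eq_exp_smul {p q : ℕ} {F : ℝ → Matrix (Fin p) (Fin q) ℂ} {lam : ℂ}
    (hF : ∀ t, HasMatDeriv F (lam • F t) t) (t : ℝ) : F t = Complex.exp (lam * t) • F 0 := by
  have h := HasMatDeriv.eq_of_forall_zero (fun t =>
    (HasMatDeriv.smul (hasDerivAt_cexp_ofReal (-lam) 0 t) (hF t)).congr_deriv (by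
      rw [smul_smul, ← add_smul]
      convert zero_smul ℂ (F t) using 2
      ring)) t 0
  simp only [add_zero, Complex.ofReal_zero, mul_zero, Complex.exp_zero, one_smul] at h
  rw [← h, smul_smul, ← Complex.exp_add]
  simp

namespace ComplexCoeffs

variable {n d : ℕ} (T : ComplexCoeffs n d)

/-- The integrand `e^{λt} C e^{tA}` of the Laplace transform of the distributed delay, without the
factor `B`. -/
def laplaceIntegrand (lam : ℂ) (t : ℝ) : Matrix (Fin n) (Fin d) ℂ :=
  Complex.exp (lam * t) • (T.C * matExp T.A t)

/-- The entrywise integral of `e^{λθ} C e^{θA}` over `[-h, 0]`. -/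
def laplaceKernel (lam : ℂ) : Matrix (Fin n) (Fin d) ℂ :=
  Matrix.of fun i j => ∫ θ in (-T.h)..0, T.laplaceIntegrand lam θ i j

/-- The characteristic matrix `λI - A₀ - e^{-λh} A₁ - K(λ) B`, where `K` is the Laplace kernel. -/
def charMatrix (lam : ℂ) : Matrix (Fin n) (Fin n) ℂ :=
  lam • (1 : Matrix (Fin n) (Fin n) ℂ) - T.A₀ - Complex.exp (-lam * T.h) • T.A₁
    - T.laplaceKernel lam * T.B

theorem continuous_laplaceIntegrand (lam : ℂ) (i : Fin n) (j : Fin d) :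
    Continuous fun t => T.laplaceIntegrand lam t i j :=
  HasMatDeriv.continuous_entry (fun t => HasMatDeriv.smul
    (by simpa using hasDerivAt_cexp_ofReal lam 0 t) ((hasMatDeriv_matExp T.A t).const_mul T.C)) i j

/-- A primitive of the integrand vanishing at `0`; its value at `-h` is minus the Laplace kernel.
All computations with the kernel go through this primitive. -/
theorem exists_laplacePrimitive (lam : ℂ) :
    ∃ H : ℝ → Matrix (Fin n) (Fin d) ℂ, H 0 = 0 ∧
      (∀ t, HasMatDeriv H (T.laplaceIntegrand lam t) t) ∧ H (-T.h) = -T.laplaceKernel lam := by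
  obtain ⟨H, hH0, hH⟩ := HasMatDeriv.exists_primitive (T.continuous_laplaceIntegrand lam)
  refine ⟨H, hH0, hH, ?_⟩
  ext i j
  have h := HasMatDeriv.integral_eq_sub hH (T.continuous_laplaceIntegrand lam) (-T.h) 0 i j
  simp [laplaceKernel, h, hH0]

theorem laplaceIntegrand_add (lam : ℂ) (s t : ℝ) : T.laplaceIntegrand lam (s + t) =
    Complex.exp (lam * t) • (T.laplaceIntegrand lam s * matExp T.A t) := by
  simp only [laplaceIntegrand, matExp_add, Matrix.smul_mul, smul_smul, ← Complex.exp_add,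
    Matrix.mul_assoc]
  congr 2
  push_cast
  ring

/-- As a function of `s`, both sides have the derivative `e^{λ(s+t)} C e^{(s+t)A}`. -/
theorem laplacePrimitive_add {lam : ℂ} {H : ℝ → Matrix (Fin n) (Fin d) ℂ} (hH0 : H 0 = 0)
    (hH : ∀ t, HasMatDeriv H (T.laplaceIntegrand lam t) t) (s t : ℝ) :
    H (s + t) = H t + Complex.exp (lam * t) • (H s * matExp T.A t) := by
  have h := HasMatDeriv.eq_of_forall_zero (F := fun s => H (s + t) -
    Complex.exp (lam * t) • (H s * matExp T.A t)) (fun s => ((hH (s + t)).comp_add_const.sub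
      (((hH s).mul_const _).const_smul _)).congr_deriv (by
        rw [laplaceIntegrand_add, sub_self])) s 0
  simp only [zero_add, hH0, Matrix.zero_mul, smul_zero, sub_zero] at h
  rw [← h]
  abel

variable {T} {Ω : ComplexUnknowns n d}

/-- On an eigenvector of the time shift, `Ω₁ = e^{λt} P` and `Ω₂ = e^{λ(t-h)} P`; the first
differential equation at `0` then says that `P` is annihilated by the characteristic matrix. -/
theorem IsHomogeneousSolution.mul_charMatrix (hΩ : T.IsHomogeneousSolution Ω) {lam : ℂ}
    (h₁ : ∀ t, Ω.Ω₁ t = Complex.exp (lam * t) • Ω.Ω₁ 0)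
    (h₂ : ∀ t, Ω.Ω₂ t = Complex.exp (lam * (t - T.h)) • Ω.Ω₁ 0) :
    Ω.Ω₁ 0 * T.charMatrix lam = 0 := by
  obtain ⟨H, hH0, hH, hHh⟩ := T.exists_laplacePrimitive lam
  have h := HasMatDeriv.eq_of_forall_zero (fun t => (((hΩ.deriv₄ t).mul
    (hasMatDeriv_matExp' T.A t)).add (((hH (-T.h + t)).comp_const_add).const_mul
      (Ω.Ω₁ 0))).congr_deriv (by
      have e : T.Ch * matExp T.A t = T.C * matExp T.A (-T.h + t) := by
        rw [matExp_add, Ch, Matrix.mul_assoc]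
      simp only [laplaceIntegrand, Matrix.sub_mul, Matrix.neg_mul, Matrix.mul_assoc, e, h₂,
        Matrix.smul_mul, Matrix.mul_smul]
      rw [show lam * ((-T.h + t : ℝ) : ℂ) = lam * (t - T.h) by push_cast; ring]
      abel)) 0 T.h
  simp only [matExp_zero, Matrix.mul_one, add_zero, neg_add_cancel, hHh, hH0, hΩ.boundary₄,
    Matrix.zero_mul, Matrix.mul_zero, Matrix.mul_neg] at h
  -- The conserved quantity `Ω₄ e^{tA} + P H(t - h)` has been evaluated at `0` and at `h`.
  have h₄ : Ω.Ω₄ 0 = Ω.Ω₁ 0 * T.laplaceKernel lam := by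
    rwa [← sub_eq_add_neg, sub_eq_zero] at h
  have hd : HasMatDeriv Ω.Ω₁ (lam • Ω.Ω₁ 0) 0 := by
    have h := HasMatDeriv.smul (hasDerivAt_cexp_ofReal lam 0 0) (HasMatDeriv.const (Ω.Ω₁ 0))
    simp only [add_zero, ← h₁] at h
    simpa using h
  have key := hd.unique (hΩ.deriv₁ 0)
  rw [hΩ.boundary₃, h₄, h₂] at key
  simp only [charMatrix, Matrix.mul_sub, Matrix.mul_smul, Matrix.mul_one, key]
  simp [Matrix.mul_assoc]
  abel

/-- When `Ω₁` and `Ω₂` vanish, the other four unknowns solve homogeneous linear initial value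
problems. -/
theorem IsHomogeneousSolution.eq_zero (hΩ : T.IsHomogeneousSolution Ω) (h₁ : ∀ t, Ω.Ω₁ t = 0)
    (h₂ : ∀ t, Ω.Ω₂ t = 0) : Ω = 0 := by
  have hx : ∀ {F : ℝ → Matrix (Fin n) (Fin d) ℂ}, (∀ t, HasMatDeriv F (-(F t * T.A)) t) →
      ∀ a, F a = 0 → ∀ t, F t = 0 := fun {F} hF a ha t => by
    refine eq_zero_of_mul_matExp T.A (t := t) ?_
    rw [HasMatDeriv.eq_of_forall_zero (F := fun t => F t * matExp T.A t) (fun s =>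
      ((hF s).mul (hasMatDeriv_matExp' T.A s)).congr_deriv (by simp [Matrix.mul_assoc])) t a,
      ha, Matrix.zero_mul]
  have h₃₄ : ∀ {Θ : ComplexUnknowns n d}, T.IsHomogeneousSolution Θ → (∀ t, Θ.Ω₁ t = 0) →
      (∀ t, Θ.Ω₂ t = 0) → (∀ t, Θ.Ω₃ t = 0) ∧ ∀ t, Θ.Ω₄ t = 0 := fun hΘ h₁ h₂ =>
    ⟨hx (fun t => (hΘ.deriv₃ t).congr_deriv (by simp [h₁])) 0 hΘ.boundary₃,
      hx (fun t => (hΘ.deriv₄ t).congr_deriv (by simp [h₂])) T.h hΘ.boundary₄⟩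
  obtain ⟨h₃, h₄⟩ := h₃₄ hΩ h₁ h₂
  obtain ⟨h₆, h₅⟩ := h₃₄ hΩ.reflect (fun t => by simp [h₂]) (fun t => by simp [h₁])
  refine ComplexUnknowns.ext_apply h₁ h₂ h₃ h₄ (fun t => ?_) (fun t => ?_)
  · simpa using h₅ (T.h - t)
  · simpa using h₆ (T.h - t)

/-- An eigenvector of the time shift on a nonzero finite-dimensional space of homogeneous solutions
yields a matrix annihilated by the characteristic matrices at `λ` and, transposed, at `-λ`. -/
theorem exists_mul_charMatrix_eq_zero [FiniteDimensional ℂ T.homogeneousSolutions]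
    [Nontrivial T.homogeneousSolutions] :
    ∃ (lam : ℂ) (P : Matrix (Fin n) (Fin n) ℂ), P ≠ 0 ∧ P * T.charMatrix lam = 0 ∧
      Pᵀ * T.charMatrix (-lam) = 0 := by
  obtain ⟨lam, hlam⟩ := Module.End.exists_eigenvalue T.shiftEnd
  obtain ⟨⟨Ω, hΩ⟩, hv⟩ := hlam.exists_hasEigenvector
  have he : T.shift Ω = lam • Ω := congrArg Subtype.val hv.apply_eq_smul
  have hne : Ω ≠ 0 := fun h => hv.2 (Subtype.ext h)
  replace hΩ : T.IsHomogeneousSolution Ω := hΩ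
  have h₁ : ∀ t, Ω.Ω₁ t = Complex.exp (lam * t) • Ω.Ω₁ 0 :=
    HasMatDeriv.eq_exp_smul fun t => (hΩ.deriv₁ t).congr_deriv (by
      rw [← shift_Ω₁, he, ComplexUnknowns.smul_Ω₁])
  have h₂' : ∀ t, Ω.Ω₂ t = Complex.exp (lam * t) • Ω.Ω₂ 0 :=
    HasMatDeriv.eq_exp_smul fun t => (hΩ.deriv₂ t).congr_deriv (by
      rw [← shift_Ω₂, he, ComplexUnknowns.smul_Ω₂])
  have h₂ : ∀ t : ℝ, Ω.Ω₂ t = Complex.exp (lam * (t - T.h)) • Ω.Ω₁ 0 := fun t => by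
    rw [hΩ.boundary₁₂, h₂' t, h₂' T.h, smul_smul, ← Complex.exp_add]
    congr 2
    ring
  refine ⟨lam, Ω.Ω₁ 0, fun hP => hne (hΩ.eq_zero (fun t => ?_) fun t => ?_),
    hΩ.mul_charMatrix h₁ h₂, ?_⟩
  · rw [h₁, hP, smul_zero]
  · rw [h₂, hP, smul_zero]
  · have h := hΩ.reflect.mul_charMatrix (lam := -lam) (fun t => ?_) (fun t => ?_)
    · simpa [← hΩ.boundary₁₂] using h
    · simp only [ComplexUnknowns.reflect_Ω₁, sub_zero, ← hΩ.boundary₁₂, h₂ (T.h - t)]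
      rw [Matrix.transpose_smul]
      congr 2
      push_cast
      ring
    · simp only [ComplexUnknowns.reflect_Ω₁, ComplexUnknowns.reflect_Ω₂, sub_zero,
        ← hΩ.boundary₁₂, h₁ (T.h - t)]
      rw [Matrix.transpose_smul]
      congr 2
      push_cast
      ring

/-- If `P` is annihilated by the characteristic matrix at `λ`, then the exponentials `e^{λt} P` and
`e^{λ(t-h)} P` extend to a solution of the equations that involve only `Ω₁, …, Ω₄`. -/
theorem exists_exponential_solution {lam : ℂ} {P : Matrix (Fin n) (Fin n) ℂ}
    (hP : P * T.charMatrix lam = 0) :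
    ∃ F G : ℝ → Matrix (Fin n) (Fin d) ℂ, F 0 = 0 ∧ G T.h = 0 ∧
      (∀ t, HasMatDeriv F (-(F t * T.A) + (Complex.exp (lam * t) • P) * T.C) t) ∧
      (∀ t, HasMatDeriv G (-(G t * T.A) - (Complex.exp (lam * (t - T.h)) • P) * T.Ch) t) ∧
      ∀ t : ℝ, lam • Complex.exp (lam * t) • P = (Complex.exp (lam * t) • P) * T.A₀ +
        (Complex.exp (lam * (t - T.h)) • P) * T.A₁ + F t * T.B + G t * T.B := by
  obtain ⟨H, hH0, hH, hHh⟩ := T.exists_laplacePrimitive lam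
  refine ⟨fun t => P * H t * matExp T.A (-t), fun t => -(P * H (-T.h + t) * matExp T.A (-t)),
    by simp [hH0], by simp [hH0], fun t => ?_, fun t => ?_, fun t => ?_⟩
  · refine (((hH t).const_mul P).mul (hasMatDeriv_matExp_neg T.A t)).congr_deriv ?_
    simp only [laplaceIntegrand, Matrix.mul_assoc, Matrix.smul_mul, Matrix.mul_smul,
      matExp_mul_neg, Matrix.mul_one, Matrix.mul_neg]
    abel
  · refine ((((hH (-T.h + t)).comp_const_add.const_mul P).mul
      (hasMatDeriv_matExp_neg T.A t)).neg).congr_deriv ?_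
    simp only [laplaceIntegrand, matExp_add, Matrix.mul_assoc, Matrix.smul_mul, Matrix.mul_smul,
      matExp_mul_neg, Matrix.mul_one, Matrix.mul_neg, Matrix.neg_mul, Ch]
    rw [show lam * ((-T.h + t : ℝ) : ℂ) = lam * (t - T.h) by push_cast; ring]
    abel
  · beta_reduce
    rw [T.laplacePrimitive_add hH0 hH (-T.h) t, hHh]
    simp only [charMatrix, Matrix.mul_sub, Matrix.mul_smul, Matrix.mul_one] at hP
    rw [sub_eq_zero, sub_eq_iff_eq_add, sub_eq_iff_eq_add] at hP
    rw [smul_comm, hP]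
    simp only [Matrix.mul_add, Matrix.add_mul, Matrix.smul_mul, Matrix.mul_smul, Matrix.neg_mul,
      Matrix.mul_neg, Matrix.mul_assoc, smul_neg, smul_add, smul_smul, ← Complex.exp_add]
    rw [← Matrix.mul_assoc (matExp T.A t), matExp_mul_neg, Matrix.one_mul,
      show lam * t + -lam * T.h = lam * (t - T.h) by ring]
    abel

/-- A matrix annihilated as in `exists_mul_charMatrix_eq_zero` gives rise to an exponential
homogeneous solution. -/
theorem exists_homogeneousSolution {lam : ℂ} {P : Matrix (Fin n) (Fin n) ℂ}
    (hP : P * T.charMatrix lam = 0) (hP' : Pᵀ * T.charMatrix (-lam) = 0) :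
    ∃ Ω : ComplexUnknowns n d, T.IsHomogeneousSolution Ω ∧ Ω.Ω₁ 0 = P := by
  obtain ⟨F, G, hF0, hGh, hF, hG, h⟩ := exists_exponential_solution hP
  obtain ⟨F', G', hF0', hGh', hF', hG', h'⟩ := exists_exponential_solution hP'
  have hd : ∀ c t : ℝ, HasMatDeriv (fun t : ℝ => Complex.exp (lam * (t + c)) • P)
      (lam • Complex.exp (lam * (t + c)) • P) t := fun c t => by
    have h := HasMatDeriv.smul (hasDerivAt_cexp_ofReal lam c t) (HasMatDeriv.const P)
    simpa [smul_smul] using h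
  have hd₁ : ∀ t : ℝ, HasMatDeriv (fun t : ℝ => Complex.exp (lam * t) • P)
      (lam • Complex.exp (lam * t) • P) t := fun t => by simpa using hd 0 t
  have hd₂ : ∀ t : ℝ, HasMatDeriv (fun t : ℝ => Complex.exp (lam * (t - T.h)) • P)
      (lam • Complex.exp (lam * (t - T.h)) • P) t := fun t => by
    simpa [sub_eq_add_neg] using hd (-T.h) t
  have e₁ : ∀ t : ℝ, -lam * ((T.h - t : ℝ) : ℂ) = lam * (t - T.h) := fun t => by
    push_cast; ring
  have e₂ : ∀ t : ℝ, -lam * (((T.h - t : ℝ) : ℂ) - T.h) = lam * t := fun t => by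
    push_cast; ring
  have h'' : ∀ t : ℝ, lam • Complex.exp (lam * (t - T.h)) • P =
      -(T.A₁ᵀ * (Complex.exp (lam * t) • P)) - T.A₀ᵀ * (Complex.exp (lam * (t - T.h)) • P)
        - T.Bᵀ * (G' (T.h - t))ᵀ - T.Bᵀ * (F' (T.h - t))ᵀ := fun t => by
    have h := congrArg (fun M => -Mᵀ) (h' (T.h - t))
    simp only [e₁, e₂] at h
    simp only [Matrix.transpose_add, Matrix.transpose_mul, Matrix.transpose_smul,
      Matrix.transpose_transpose, Matrix.transpose_neg, neg_smul, neg_neg] at h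
    rw [h]
    abel
  refine ⟨(fun t : ℝ => Complex.exp (lam * t) • P, fun t : ℝ => Complex.exp (lam * (t - T.h)) • P,
    F, G, fun t => (G' (T.h - t))ᵀ, fun t => (F' (T.h - t))ᵀ), ?_, by simp⟩
  exact
    { deriv₁ := fun t => (hd₁ t).congr_deriv (h t)
      deriv₂ := fun t => (hd₂ t).congr_deriv (h'' t)
      deriv₃ := hF
      deriv₄ := hG
      deriv₅ := fun t => (hG' (T.h - t)).comp_const_sub.transpose.congr_deriv (by
        simp only [ComplexUnknowns.mk_Ω₅, ComplexUnknowns.mk_Ω₁, e₂]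
        simp only [Matrix.transpose_neg, Matrix.transpose_sub, Matrix.transpose_mul,
          Matrix.transpose_smul, Matrix.transpose_transpose]
        abel)
      deriv₆ := fun t => (hF' (T.h - t)).comp_const_sub.transpose.congr_deriv (by
        simp only [ComplexUnknowns.mk_Ω₆, ComplexUnknowns.mk_Ω₂, e₁]
        simp only [Matrix.transpose_neg, Matrix.transpose_add, Matrix.transpose_mul,
          Matrix.transpose_smul, Matrix.transpose_transpose]
        abel)
      algebraic := by
        have h₁ := h 0
        have h₂ := h'' T.h
        simp only [ComplexUnknowns.mk_Ω₁, ComplexUnknowns.mk_Ω₂, ComplexUnknowns.mk_Ω₄,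
          ComplexUnknowns.mk_Ω₅, Complex.ofReal_zero, mul_zero, sub_self, Complex.exp_zero,
          one_smul, hF0, hF0', Matrix.transpose_zero, Matrix.zero_mul, Matrix.mul_zero] at h₁ h₂ ⊢
        rw [h₁, ← sub_eq_zero] at h₂
        rw [← h₂]
        abel
      boundary₁₂ := by simp
      boundary₃ := hF0
      boundary₄ := hGh
      boundary₅ := by simp [hGh']
      boundary₆ := by simp [hF0'] }

end ComplexCoeffs

/-! ### Passage between real and complex solutions -/

/-- The value at one time of the six unknowns. -/
abbrev ODEcState (n d : ℕ) : Type :=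
  Matrix (Fin n) (Fin n) ℝ × Matrix (Fin n) (Fin n) ℝ × Matrix (Fin n) (Fin d) ℝ ×
  Matrix (Fin n) (Fin d) ℝ × Matrix (Fin d) (Fin n) ℝ × Matrix (Fin d) (Fin n) ℝ

namespace ODEcUnknowns

variable {n d : ℕ}

/-- The trajectory in the state space that corresponds to six functions. -/
def state (Ω : ODEcUnknowns n d) (t : ℝ) : ODEcState n d :=
  (Ω.Ω₁ t, Ω.Ω₂ t, Ω.Ω₃ t, Ω.Ω₄ t, Ω.Ω₅ t, Ω.Ω₆ t)

/-- The six functions that correspond to a trajectory in the state space. -/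
def ofState (x : ℝ → ODEcState n d) : ODEcUnknowns n d where
  Ω₁ t := (x t).1
  Ω₂ t := (x t).2.1
  Ω₃ t := (x t).2.2.1
  Ω₄ t := (x t).2.2.2.1
  Ω₅ t := (x t).2.2.2.2.1
  Ω₆ t := (x t).2.2.2.2.2

theorem state_ofState (x : ℝ → ODEcState n d) : (ofState x).state = x := rfl

theorem ofState_state (Ω : ODEcUnknowns n d) : ofState Ω.state = Ω := rfl

theorem state_injective : Function.Injective (state (n := n) (d := d)) :=
  Function.LeftInverse.injective ofState_state

/-- The six functions with entries in `ℂ`. -/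
def complexify (Ω : ODEcUnknowns n d) : ComplexUnknowns n d :=
  (fun t => (Ω.Ω₁ t).map Complex.ofReal, fun t => (Ω.Ω₂ t).map Complex.ofReal,
    fun t => (Ω.Ω₃ t).map Complex.ofReal, fun t => (Ω.Ω₄ t).map Complex.ofReal,
    fun t => (Ω.Ω₅ t).map Complex.ofReal, fun t => (Ω.Ω₆ t).map Complex.ofReal)

/-- Six real functions obtained by applying a real functional, such as the real or the imaginary
part, to every entry. -/
def ofComplex (φ : ℂ →L[ℝ] ℝ) (Ω : ComplexUnknowns n d) : ODEcUnknowns n d where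
  Ω₁ t := (Ω.Ω₁ t).map φ
  Ω₂ t := (Ω.Ω₂ t).map φ
  Ω₃ t := (Ω.Ω₃ t).map φ
  Ω₄ t := (Ω.Ω₄ t).map φ
  Ω₅ t := (Ω.Ω₅ t).map φ
  Ω₆ t := (Ω.Ω₆ t).map φ

end ODEcUnknowns

section map

variable {p q r : ℕ}

theorem map_mul_map_ofReal (φ : ℂ →L[ℝ] ℝ) (M : Matrix (Fin p) (Fin q) ℂ)
    (N : Matrix (Fin q) (Fin r) ℝ) : (M * N.map Complex.ofReal).map φ = M.map φ * N := by
  ext i j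
  simp only [Matrix.map_apply, Matrix.mul_apply, map_sum]
  refine Finset.sum_congr rfl fun k _ => ?_
  rw [mul_comm (M i k), ← Complex.real_smul, map_smul, smul_eq_mul, mul_comm]

theorem map_map_ofReal_mul (φ : ℂ →L[ℝ] ℝ) (N : Matrix (Fin p) (Fin q) ℝ)
    (M : Matrix (Fin q) (Fin r) ℂ) : (N.map Complex.ofReal * M).map φ = N * M.map φ := by
  ext i j
  simp only [Matrix.map_apply, Matrix.mul_apply, map_sum]
  refine Finset.sum_congr rfl fun k _ => ?_
  rw [← Complex.real_smul, map_smul, smul_eq_mul]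

theorem map_ofReal_mul (M : Matrix (Fin p) (Fin q) ℝ) (N : Matrix (Fin q) (Fin r) ℝ) :
    (M * N).map Complex.ofReal = M.map Complex.ofReal * N.map Complex.ofReal :=
  Matrix.map_mul (f := Complex.ofRealHom)

theorem map_ofReal_neg (M : Matrix (Fin p) (Fin q) ℝ) :
    (-M).map Complex.ofReal = -M.map Complex.ofReal := by
  ext
  simp

theorem HasMatrixDeriv.complexify {F : ℝ → Matrix (Fin p) (Fin q) ℝ}
    {F' : Matrix (Fin p) (Fin q) ℝ} {τ : ℝ} (hF : HasMatrixDeriv F F' τ) :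
    HasMatDeriv (fun t => (F t).map Complex.ofReal) (F'.map Complex.ofReal) τ :=
  fun i j => (hF i j).ofReal_comp

theorem HasMatDeriv.map {F : ℝ → Matrix (Fin p) (Fin q) ℂ} {F' : Matrix (Fin p) (Fin q) ℂ}
    {τ : ℝ} (hF : HasMatDeriv F F' τ) (φ : ℂ →L[ℝ] ℝ) :
    HasMatrixDeriv (fun t => (F t).map φ) (F'.map φ) τ :=
  fun i j => φ.hasFDerivAt.comp_hasDerivAt τ (hF i j)

theorem HasMatrixDeriv.congr_deriv {F : ℝ → Matrix (Fin p) (Fin q) ℝ}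
    {F' G' : Matrix (Fin p) (Fin q) ℝ} {τ : ℝ} (hF : HasMatrixDeriv F F' τ) (e : F' = G') :
    HasMatrixDeriv F G' τ := e ▸ hF

theorem eq_zero_of_map_re_im {M : Matrix (Fin p) (Fin q) ℂ} (hre : M.map Complex.reCLM = 0)
    (him : M.map Complex.imCLM = 0) : M = 0 := by
  ext i j
  exact Complex.ext (congrFun (congrFun hre i) j) (congrFun (congrFun him i) j)

theorem eq_zero_of_map_ofReal {M : Matrix (Fin p) (Fin q) ℝ} (h : M.map Complex.ofReal = 0) :
    M = 0 := by
  ext i j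
  exact Complex.ofReal_injective (congrFun (congrFun h i) j)

end map

namespace DelaySystem

variable {n d : ℕ} (S : DelaySystem n d)

/-- The coefficients of the delay system with entries in `ℂ`. -/
def complexify : ComplexCoeffs n d where
  h := S.h
  A₀ := S.A₀.map Complex.ofReal
  A₁ := S.A₁.map Complex.ofReal
  C := S.C_d.map Complex.ofReal
  A := S.A_d.map Complex.ofReal
  B := S.B_d.map Complex.ofReal

theorem complexify_Ch : S.complexify.Ch = S.C_dh.map Complex.ofReal := by
  rw [ComplexCoeffs.Ch, C_dh, map_ofReal_mul, map_ofReal_exp]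
  rfl

/-- The factor `B_d` is pulled out of the entrywise integral by the fundamental theorem of
calculus, applied to a primitive multiplied by `B_d`. -/
theorem complexify_charMatrix (lam : ℂ) : S.complexify.charMatrix lam = S.charMatrix lam := by
  rw [ComplexCoeffs.charMatrix, charMatrix]
  congr 1
  ext i j
  obtain ⟨H, hH0, hH, hHh⟩ := S.complexify.exists_laplacePrimitive lam
  have h := HasMatDeriv.integral_eq_sub
    (fun t => (hH t).mul_const (S.B_d.map Complex.ofReal)) (fun i j => by
      simp only [Matrix.mul_apply]
      exact continuous_finsetSum _ fun k _ =>
        (S.complexify.continuous_laplaceIntegrand lam i k).mul continuous_const) (-S.h) 0 i j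
  have e : H (-S.h) = -S.complexify.laplaceKernel lam := hHh
  rw [hH0, e] at h
  simp only [Matrix.zero_mul, Matrix.neg_mul, zero_sub, neg_neg] at h
  rw [Matrix.of_apply]
  refine h.symm.trans (congrArg (fun f => ∫ θ in (-S.h)..0, f θ) (funext fun θ => ?_))
  have e₂ : (S.A_D θ i j : ℂ) = ((S.A_D θ).map Complex.ofReal) i j := rfl
  rw [e₂, A_D, map_ofReal_mul, map_ofReal_mul, map_ofReal_exp, ComplexCoeffs.laplaceIntegrand,
    Matrix.smul_mul]
  rfl

variable {S}

theorem IsODEcSolution.complexify {Ω : ODEcUnknowns n d} (hΩ : S.IsODEcSolution 0 Ω) :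
    S.complexify.IsHomogeneousSolution Ω.complexify where
  deriv₁ τ := (hΩ.deriv₁ τ).complexify.congr_deriv (by
    simp [Matrix.map_add, map_ofReal_mul]; rfl)
  deriv₂ τ := (hΩ.deriv₂ τ).complexify.congr_deriv (by
    simp [Matrix.map_sub, map_ofReal_neg, map_ofReal_mul]; rfl)
  deriv₃ τ := (hΩ.deriv₃ τ).complexify.congr_deriv (by
    simp [Matrix.map_add, map_ofReal_neg, map_ofReal_mul]; rfl)
  deriv₄ τ := (hΩ.deriv₄ τ).complexify.congr_deriv (by
    simp [Matrix.map_sub, map_ofReal_neg, map_ofReal_mul, complexify_Ch]; rfl)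
  deriv₅ τ := (hΩ.deriv₅ τ).complexify.congr_deriv (by
    simp [Matrix.map_add, map_ofReal_mul, complexify_Ch]; rfl)
  deriv₆ τ := (hΩ.deriv₆ τ).complexify.congr_deriv (by
    simp [Matrix.map_sub, map_ofReal_mul]; rfl)
  algebraic := by
    have h := congrArg (fun M => M.map Complex.ofReal) hΩ.algebraic
    simp [Matrix.map_add, map_ofReal_mul] at h
    exact h.symm
  boundary₁₂ := congrArg (fun M => M.map Complex.ofReal) (sub_eq_zero.1 hΩ.boundary₁₂.symm)
  boundary₃ := by simp [ODEcUnknowns.complexify, ← hΩ.boundary₃]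
  boundary₄ := by simp [ODEcUnknowns.complexify, DelaySystem.complexify, ← hΩ.boundary₄]
  boundary₅ := by simp [ODEcUnknowns.complexify, ← hΩ.boundary₅]
  boundary₆ := by simp [ODEcUnknowns.complexify, DelaySystem.complexify, ← hΩ.boundary₆]

theorem isODEcSolution_ofComplex {Ω : ComplexUnknowns n d}
    (hΩ : S.complexify.IsHomogeneousSolution Ω) (φ : ℂ →L[ℝ] ℝ) :
    S.IsODEcSolution 0 (ODEcUnknowns.ofComplex φ Ω) := by
  have hadd : ∀ {p q : ℕ} (M N : Matrix (Fin p) (Fin q) ℂ),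
      (M + N).map φ = M.map φ + N.map φ := fun M N => Matrix.map_add φ (map_add φ) M N
  have hsub : ∀ {p q : ℕ} (M N : Matrix (Fin p) (Fin q) ℂ),
      (M - N).map φ = M.map φ - N.map φ := fun M N => Matrix.map_sub φ (map_sub φ) M N
  have hneg : ∀ {p q : ℕ} (M : Matrix (Fin p) (Fin q) ℂ), (-M).map φ = -M.map φ :=
    fun M => by ext; simp
  have hzero : ∀ {p q : ℕ}, (0 : Matrix (Fin p) (Fin q) ℂ).map φ = 0 := by
    intros; ext; simp
  constructor
  · exact fun τ => ((hΩ.deriv₁ τ).map φ).congr_deriv (by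
      simp only [complexify, hadd, map_mul_map_ofReal]; rfl)
  · exact fun τ => ((hΩ.deriv₂ τ).map φ).congr_deriv (by
      simp only [complexify, hsub, hneg, ← Matrix.transpose_map, map_map_ofReal_mul]; rfl)
  · exact fun τ => ((hΩ.deriv₃ τ).map φ).congr_deriv (by
      simp only [complexify, hadd, hneg, map_mul_map_ofReal]; rfl)
  · exact fun τ => ((hΩ.deriv₄ τ).map φ).congr_deriv (by
      rw [complexify_Ch]
      simp only [complexify, hsub, hneg, map_mul_map_ofReal]; rfl)
  · exact fun τ => ((hΩ.deriv₅ τ).map φ).congr_deriv (by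
      rw [complexify_Ch]
      simp only [complexify, hadd, ← Matrix.transpose_map, map_map_ofReal_mul]; rfl)
  · exact fun τ => ((hΩ.deriv₆ τ).map φ).congr_deriv (by
      simp only [complexify, hsub, ← Matrix.transpose_map, map_map_ofReal_mul]; rfl)
  · have h := congrArg (fun M => M.map φ) hΩ.algebraic
    simp only [complexify, hadd, hzero, ← Matrix.transpose_map, map_map_ofReal_mul,
      map_mul_map_ofReal] at h
    rw [neg_zero]
    exact h.symm
  · rw [eq_comm, sub_eq_zero]
    exact congrArg (fun M => M.map φ) hΩ.boundary₁₂
  · exact ((congrArg (fun M => M.map φ) hΩ.boundary₃).trans hzero).symm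
  · exact ((congrArg (fun M => M.map φ) hΩ.boundary₄).trans hzero).symm
  · exact ((congrArg (fun M => M.map φ) hΩ.boundary₅).trans hzero).symm
  · exact ((congrArg (fun M => M.map φ) hΩ.boundary₆).trans hzero).symm

end DelaySystem

/-! ### The boundary value problem as a linear equation -/

namespace DelaySystem

variable {n d : ℕ} (S : DelaySystem n d)

/-- The right-hand side of the differential equations of the ODEc. -/
def vectorField : ODEcState n d →ₗ[ℝ] ODEcState n d where
  toFun x := (x.1 * S.A₀ + x.2.1 * S.A₁ + x.2.2.1 * S.B_d + x.2.2.2.1 * S.B_d,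
    -(S.A₁ᵀ * x.1) - S.A₀ᵀ * x.2.1 - S.B_dᵀ * x.2.2.2.2.1 - S.B_dᵀ * x.2.2.2.2.2,
    -(x.2.2.1 * S.A_d) + x.1 * S.C_d,
    -(x.2.2.2.1 * S.A_d) - x.2.1 * S.C_dh,
    S.A_dᵀ * x.2.2.2.2.1 + S.C_dhᵀ * x.1,
    S.A_dᵀ * x.2.2.2.2.2 - S.C_dᵀ * x.2.1)
  map_add' x y := by
    refine Prod.ext ?_ (Prod.ext ?_ (Prod.ext ?_ (Prod.ext ?_ (Prod.ext ?_ ?_)))) <;>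
      simp [Matrix.add_mul, Matrix.mul_add] <;> abel
  map_smul' c x := by
    refine Prod.ext ?_ (Prod.ext ?_ (Prod.ext ?_ (Prod.ext ?_ (Prod.ext ?_ ?_)))) <;>
      simp [smul_sub]

/-- The boundary expressions of the ODEc in terms of the states `x` at `0` and `y` at `h`. -/
def boundaryMap : ODEcState n d × ODEcState n d →ₗ[ℝ] ODEcState n d where
  toFun z := (z.1.1 * S.A₀ + z.1.2.1 * S.A₁ + z.1.2.2.2.1 * S.B_d
      + S.A₁ᵀ * z.2.1 + S.A₀ᵀ * z.2.2.1 + S.B_dᵀ * z.2.2.2.2.2.1,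
    z.1.1 - z.2.2.1, z.1.2.2.1, z.2.2.2.2.1, z.1.2.2.2.2.1, z.2.2.2.2.2.2)
  map_add' x y := by
    refine Prod.ext ?_ (Prod.ext ?_ (Prod.ext ?_ (Prod.ext ?_ (Prod.ext ?_ ?_)))) <;>
      simp [Matrix.add_mul, Matrix.mul_add] <;> abel
  map_smul' c x := by
    refine Prod.ext ?_ (Prod.ext ?_ (Prod.ext ?_ (Prod.ext ?_ (Prod.ext ?_ ?_)))) <;>
      simp [smul_sub]

section flow

attribute [local instance] Matrix.normedAddCommGroup Matrix.normedSpace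

theorem hasMatrixDeriv_iff {p q : ℕ} {F : ℝ → Matrix (Fin p) (Fin q) ℝ}
    {F' : Matrix (Fin p) (Fin q) ℝ} {τ : ℝ} : HasMatrixDeriv F F' τ ↔ HasDerivAt F F' τ := by
  exact (forall_congr' fun i => (hasDerivAt_pi (φ := fun t => F t i) (φ' := F' i)).symm).trans
    (hasDerivAt_pi (φ := F) (φ' := F')).symm

/-- The ODEc as one differential equation in the normed state space together with one linear
boundary condition. The choice of norms on matrices is immaterial in finite dimension. -/
theorem isODEcSolution_iff {Q : Matrix (Fin n) (Fin n) ℝ} {Ω : ODEcUnknowns n d} :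
    S.IsODEcSolution Q Ω ↔ (∀ τ, HasDerivAt Ω.state (S.vectorField (Ω.state τ)) τ) ∧
      S.boundaryMap (Ω.state 0, Ω.state S.h) = (-Q, 0) := by
  constructor
  · intro h
    refine ⟨fun τ => ?_, ?_⟩
    · exact (hasMatrixDeriv_iff.1 (h.deriv₁ τ)).prodMk ((hasMatrixDeriv_iff.1 (h.deriv₂ τ)).prodMk
        ((hasMatrixDeriv_iff.1 (h.deriv₃ τ)).prodMk ((hasMatrixDeriv_iff.1 (h.deriv₄ τ)).prodMk
        ((hasMatrixDeriv_iff.1 (h.deriv₅ τ)).prodMk (hasMatrixDeriv_iff.1 (h.deriv₆ τ))))))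
    · exact Prod.ext h.algebraic.symm (Prod.ext h.boundary₁₂.symm (Prod.ext h.boundary₃.symm
        (Prod.ext h.boundary₄.symm (Prod.ext h.boundary₅.symm h.boundary₆.symm))))
  · rintro ⟨h, hb⟩
    have h₁ := fun τ => (hasFDerivAt_fst (𝕜 := ℝ)).comp_hasDerivAt τ (h τ)
    have g₁ := fun τ => (hasFDerivAt_snd (𝕜 := ℝ)).comp_hasDerivAt τ (h τ)
    have h₂ := fun τ => (hasFDerivAt_fst (𝕜 := ℝ)).comp_hasDerivAt τ (g₁ τ)
    have g₂ := fun τ => (hasFDerivAt_snd (𝕜 := ℝ)).comp_hasDerivAt τ (g₁ τ)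
    have h₃ := fun τ => (hasFDerivAt_fst (𝕜 := ℝ)).comp_hasDerivAt τ (g₂ τ)
    have g₃ := fun τ => (hasFDerivAt_snd (𝕜 := ℝ)).comp_hasDerivAt τ (g₂ τ)
    have h₄ := fun τ => (hasFDerivAt_fst (𝕜 := ℝ)).comp_hasDerivAt τ (g₃ τ)
    have g₄ := fun τ => (hasFDerivAt_snd (𝕜 := ℝ)).comp_hasDerivAt τ (g₃ τ)
    have h₅ := fun τ => (hasFDerivAt_fst (𝕜 := ℝ)).comp_hasDerivAt τ (g₄ τ)
    have h₆ := fun τ => (hasFDerivAt_snd (𝕜 := ℝ)).comp_hasDerivAt τ (g₄ τ)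
    exact
      { deriv₁ := fun τ => hasMatrixDeriv_iff.2 (h₁ τ)
        deriv₂ := fun τ => hasMatrixDeriv_iff.2 (h₂ τ)
        deriv₃ := fun τ => hasMatrixDeriv_iff.2 (h₃ τ)
        deriv₄ := fun τ => hasMatrixDeriv_iff.2 (h₄ τ)
        deriv₅ := fun τ => hasMatrixDeriv_iff.2 (h₅ τ)
        deriv₆ := fun τ => hasMatrixDeriv_iff.2 (h₆ τ)
        algebraic := (congrArg (·.1) hb).symm
        boundary₁₂ := (congrArg (·.2.1) hb).symm
        boundary₃ := (congrArg (·.2.2.1) hb).symm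
        boundary₄ := (congrArg (·.2.2.2.1) hb).symm
        boundary₅ := (congrArg (·.2.2.2.2.1) hb).symm
        boundary₆ := (congrArg (·.2.2.2.2.2) hb).symm }

/-- The flow of a linear vector field on a finite-dimensional space exists for all times and is
unique. -/
theorem exists_linear_flow {E : Type*} [NormedAddCommGroup E] [NormedSpace ℝ E]
    [FiniteDimensional ℝ E] (L : E →ₗ[ℝ] E) :
    ∃ e : ℝ → E →ₗ[ℝ] E, (∀ x, e 0 x = x) ∧ (∀ x t, HasDerivAt (fun t => e t x) (L (e t x)) t) ∧
      ∀ y : ℝ → E, (∀ t, HasDerivAt y (L (y t)) t) → ∀ t, y t = e t (y 0) := by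
  have : CompleteSpace E := FiniteDimensional.complete ℝ E
  let L' : E →L[ℝ] E := L.toContinuousLinearMap
  have hd : ∀ x t, HasDerivAt (fun t : ℝ => NormedSpace.exp (t • L') x)
      (L (NormedSpace.exp (t • L') x)) t := fun x t =>
    (ContinuousLinearMap.apply ℝ E x).hasFDerivAt.comp_hasDerivAt t
      (hasDerivAt_exp_smul_const' (𝕂 := ℝ) L' t)
  refine ⟨fun t => (NormedSpace.exp (t • L') : E →L[ℝ] E), fun x => by simp, hd, fun y hy t => ?_⟩
  have h := ODE_solution_unique_univ (v := fun _ => L') (s := fun _ => Set.univ) (t₀ := 0)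
    (K := ‖L'‖₊) (fun _ => L'.lipschitz.lipschitzOnWith) (fun t => ⟨hy t, trivial⟩)
    (fun t => ⟨hd (y 0) t, trivial⟩) (by simp)
  exact congrFun h t

/-- The boundary value problem is square: its solutions correspond to the solutions of a linear
equation for the state at `0` in which the number of equations is the number of unknowns. -/
theorem exists_boundary_endomorphism : ∃ (Φ : ODEcState n d →ₗ[ℝ] ODEcState n d)
    (sol : ODEcState n d → ODEcUnknowns n d),
    (∀ x Q, Φ x = (-Q, 0) → S.IsODEcSolution Q (sol x)) ∧ (∀ x, (sol x).state 0 = x) ∧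
    ∀ Q Ω, S.IsODEcSolution Q Ω → Ω = sol (Ω.state 0) ∧ Φ (Ω.state 0) = (-Q, 0) := by
  obtain ⟨e, he0, he, hu⟩ := exists_linear_flow S.vectorField
  refine ⟨S.boundaryMap ∘ₗ LinearMap.prod LinearMap.id (e S.h),
    fun x => ODEcUnknowns.ofState fun t => e t x, fun x Q hx => ?_, he0, fun Q Ω hΩ => ?_⟩
  · refine S.isODEcSolution_iff.2 ⟨he x, ?_⟩
    simpa [ODEcUnknowns.state_ofState, he0] using hx
  · obtain ⟨h, hb⟩ := S.isODEcSolution_iff.1 hΩ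
    have h' := hu _ h
    refine ⟨ODEcUnknowns.state_injective (funext h'), ?_⟩
    simpa [← h' S.h] using hb

end flow

theorem isODEcSolution_zero : S.IsODEcSolution 0 (ODEcUnknowns.ofState fun _ => 0) := by
  constructor <;>
    first
      | exact fun τ i j =>
          (hasDerivAt_const τ (0 : ℝ)).congr_deriv (by simp [ODEcUnknowns.ofState])
      | simp [ODEcUnknowns.ofState]

theorem IsODEcSolution.eq_of_state_zero {S : DelaySystem n d} {Q Q' : Matrix (Fin n) (Fin n) ℝ}
    {Ω Θ : ODEcUnknowns n d} (hΩ : S.IsODEcSolution Q Ω) (hΘ : S.IsODEcSolution Q' Θ)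
    (h : Ω.state 0 = Θ.state 0) : Ω = Θ := by
  obtain ⟨_, sol, _, _, h'⟩ := S.exists_boundary_endomorphism
  rw [(h' Q Ω hΩ).1, (h' Q' Θ hΘ).1, h]

/-- Fredholm alternative for the ODEc: uniqueness for `Q = 0` already gives existence and uniqueness
for every `Q`. -/
theorem forall_existsUnique_iff :
    (∀ Q : Matrix (Fin n) (Fin n) ℝ, Q.IsSymm → ∃! Ω, S.IsODEcSolution Q Ω) ↔
      ∀ Ω, S.IsODEcSolution 0 Ω → Ω = ODEcUnknowns.ofState fun _ => 0 := by
  refine ⟨fun h Ω hΩ => (h 0 Matrix.isSymm_zero).unique hΩ S.isODEcSolution_zero,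
    fun h Q _ => ?_⟩
  obtain ⟨Φ, sol, hsol, hsol0, h'⟩ := S.exists_boundary_endomorphism
  have hinj : Function.Injective Φ := by
    rw [injective_iff_map_eq_zero]
    intro x hx
    rw [← hsol0 x, h _ (hsol x 0 (by rw [hx, neg_zero]; rfl))]
    rfl
  obtain ⟨x, hx⟩ := LinearMap.injective_iff_surjective.1 hinj (-Q, 0)
  refine ⟨sol x, hsol x Q hx, fun Ω hΩ => ?_⟩
  rw [(h' Q Ω hΩ).1, hinj ((h' Q Ω hΩ).2.trans hx.symm)]

/-- Evaluation at `0` is injective, because the real and imaginary parts of a complex solution are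
real solutions, which are determined by their state at `0`. -/
theorem finiteDimensional_homogeneousSolutions :
    FiniteDimensional ℂ S.complexify.homogeneousSolutions := by
  let ev : S.complexify.homogeneousSolutions →ₗ[ℂ]
      Matrix (Fin n) (Fin n) ℂ × Matrix (Fin n) (Fin n) ℂ × Matrix (Fin n) (Fin d) ℂ ×
      Matrix (Fin n) (Fin d) ℂ × Matrix (Fin d) (Fin n) ℂ × Matrix (Fin d) (Fin n) ℂ :=
    { toFun := fun Ω => (Ω.1.Ω₁ 0, Ω.1.Ω₂ 0, Ω.1.Ω₃ 0, Ω.1.Ω₄ 0, Ω.1.Ω₅ 0, Ω.1.Ω₆ 0)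
      map_add' := fun _ _ => rfl
      map_smul' := fun _ _ => rfl }
  refine FiniteDimensional.of_injective ev ?_
  rw [injective_iff_map_eq_zero]
  rintro ⟨Ω, hΩ⟩ h0
  have hz : ∀ φ : ℂ →L[ℝ] ℝ,
      ODEcUnknowns.ofComplex φ Ω = ODEcUnknowns.ofState fun _ => 0 := fun φ => by
    refine (isODEcSolution_ofComplex hΩ φ).eq_of_state_zero S.isODEcSolution_zero ?_
    have hφ : ∀ {p q : ℕ} {M : Matrix (Fin p) (Fin q) ℂ}, M = 0 → M.map φ = 0 := by
      rintro p q _ rfl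
      ext
      simp
    exact Prod.ext (hφ (congrArg (·.1) h0)) (Prod.ext (hφ (congrArg (·.2.1) h0))
      (Prod.ext (hφ (congrArg (·.2.2.1) h0)) (Prod.ext (hφ (congrArg (·.2.2.2.1) h0))
      (Prod.ext (hφ (congrArg (·.2.2.2.2.1) h0)) (hφ (congrArg (·.2.2.2.2.2) h0))))))
  have hre := hz Complex.reCLM
  have him := hz Complex.imCLM
  refine Subtype.ext (ComplexUnknowns.ext_apply (fun t => ?_) (fun t => ?_) (fun t => ?_)
    (fun t => ?_) (fun t => ?_) fun t => ?_)
  · exact eq_zero_of_map_re_im (congrArg (·.Ω₁ t) hre) (congrArg (·.Ω₁ t) him)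
  · exact eq_zero_of_map_re_im (congrArg (·.Ω₂ t) hre) (congrArg (·.Ω₂ t) him)
  · exact eq_zero_of_map_re_im (congrArg (·.Ω₃ t) hre) (congrArg (·.Ω₃ t) him)
  · exact eq_zero_of_map_re_im (congrArg (·.Ω₄ t) hre) (congrArg (·.Ω₄ t) him)
  · exact eq_zero_of_map_re_im (congrArg (·.Ω₅ t) hre) (congrArg (·.Ω₅ t) him)
  · exact eq_zero_of_map_re_im (congrArg (·.Ω₆ t) hre) (congrArg (·.Ω₆ t) him)

variable {S}

/-- A nonzero homogeneous solution would give an eigenvector of the time shift, and thereby `λ` and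
`-λ` in the spectrum. -/
theorem SpectrumCondition.eq_zero (hS : S.SpectrumCondition) {Ω : ODEcUnknowns n d}
    (hΩ : S.IsODEcSolution 0 Ω) : Ω = ODEcUnknowns.ofState fun _ => 0 := by
  have := S.finiteDimensional_homogeneousSolutions
  have hdet : ∀ {M P : Matrix (Fin n) (Fin n) ℂ}, P ≠ 0 → P * M = 0 → M.det = 0 := by
    intro M P hP h
    by_contra hM
    apply hP
    rw [← Matrix.mul_one P, ← Matrix.mul_nonsing_inv M (isUnit_iff_ne_zero.2 hM),
      ← Matrix.mul_assoc, h, Matrix.zero_mul]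
  have hsub : Subsingleton S.complexify.homogeneousSolutions := by
    by_contra hn
    rw [not_subsingleton_iff_nontrivial] at hn
    obtain ⟨lam, P, hP, h₁, h₂⟩ :=
      ComplexCoeffs.exists_mul_charMatrix_eq_zero (T := S.complexify)
    rw [complexify_charMatrix] at h₁ h₂
    exact hS lam (hdet hP h₁)
      (hdet (fun h => hP (by rw [← Matrix.transpose_transpose P, h, Matrix.transpose_zero])) h₂)
  have h0 : Ω.complexify = 0 := congrArg Subtype.val
    (Subsingleton.elim (⟨_, hΩ.complexify⟩ : S.complexify.homogeneousSolutions) 0)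
  refine hΩ.eq_of_state_zero S.isODEcSolution_zero ?_
  exact Prod.ext (eq_zero_of_map_ofReal (congrArg (·.Ω₁ 0) h0))
    (Prod.ext (eq_zero_of_map_ofReal (congrArg (·.Ω₂ 0) h0))
    (Prod.ext (eq_zero_of_map_ofReal (congrArg (·.Ω₃ 0) h0))
    (Prod.ext (eq_zero_of_map_ofReal (congrArg (·.Ω₄ 0) h0))
    (Prod.ext (eq_zero_of_map_ofReal (congrArg (·.Ω₅ 0) h0))
    (eq_zero_of_map_ofReal (congrArg (·.Ω₆ 0) h0))))))

/-- Left null vectors `u` of the characteristic matrix at `λ` and `w` at `-λ` give a complex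
homogeneous solution with `Ω₁ 0 = w uᵀ ≠ 0`, whose real or imaginary part is nonzero. -/
theorem spectrumCondition_of_forall_eq_zero
    (h : ∀ Ω, S.IsODEcSolution 0 Ω → Ω = ODEcUnknowns.ofState fun _ => 0) :
    S.SpectrumCondition := by
  intro lam hlam hlam'
  obtain ⟨u, hu, hu'⟩ := Matrix.exists_vecMul_eq_zero_iff.2 hlam
  obtain ⟨w, hw, hw'⟩ := Matrix.exists_vecMul_eq_zero_iff.2 hlam'
  obtain ⟨Ω, hΩ, h0⟩ := ComplexCoeffs.exists_homogeneousSolution (T := S.complexify) (lam := lam)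
    (P := Matrix.vecMulVec w u)
    (by rw [complexify_charMatrix, Matrix.vecMulVec_mul, hu', Matrix.vecMulVec_zero])
    (by rw [complexify_charMatrix, Matrix.transpose_vecMulVec, Matrix.vecMulVec_mul, hw',
      Matrix.vecMulVec_zero])
  have hP := eq_zero_of_map_re_im
    (congrArg (·.Ω₁ 0) (h _ (isODEcSolution_ofComplex hΩ Complex.reCLM)))
    (congrArg (·.Ω₁ 0) (h _ (isODEcSolution_ofComplex hΩ Complex.imCLM)))
  rw [h0, Matrix.vecMulVec_eq_zero] at hP
  exact hP.elim hw hu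

end DelaySystem

theorem theorem1 {n d : ℕ} (S : DelaySystem n d) (hh : 0 ≤ S.h) :
    (∀ Q : Matrix (Fin n) (Fin n) ℝ, Q.IsSymm →
      ∃! Ω : ODEcUnknowns n d, S.IsODEcSolution Q Ω) ↔ S.SpectrumCondition :=
  S.forall_existsUnique_iff.trans
    ⟨DelaySystem.spectrumCondition_of_forall_eq_zero, fun hS _ hΩ => hS.eq_zero hΩ⟩

end
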